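/- Let $K$ be a number field, $\lambda,\mu\in K\setminus\{0\}$, and let $S$ be a finite set of places of $K$ containing all archimedean places. Let $U_S=\{x\in K\setminus\{0\}: |x|_v=1 \text{ for all } v\notin S\}$ be the group of $S$-units. Let $\rho$ be a primitive cube root of unity, $L=K(\rho)$, and let $T$ be the set of places of $L$ lying above the places in $S$. For a number field $F$ and a place $v$ of $F$ let $|\cdot|_v$ be the normalized absolute value: $|x|_v=|\sigma_v(x)|^{[F_v:\mathbb{R}]/[F:\mathbb{Q}]}$ for $v$ archimedean with corresponding embedding $\sigma_v:F\to\mathbb{C}$, and $|p|_v=p^{-[F_v:\mathbb{Q}_p]/[F:\mathbb{Q}]}$ for $v$ above the prime number $p$. For $\beta\in L$ put $H(\beta)=\prod_{V}\max\{1,|\beta|_V\}$, the product being over all places $V$ of $L$. Put $$A=\Big(\prod_{V\in T}|3|_V\Big)^{1/2}\prod_{V\in T}|\lambda\mu|_V\Big(\prod_{V\notin T}\max(|\lambda|_V,|\mu|_V)\Big)^3,$$ $$\mathcal{V}^0=\Big\{\frac{\lambda x-\rho\mu y}{\lambda x-\rho^2\mu y} : x,y\in U_S,\ \lambda x+\mu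 y=1,\ \frac{\lambda x}{\mu y}\text{ is not a root of unity}\Big\}\subset L.$$ Let $B$ be a real number with $5/6<B<1$. Fix $(\rho_V)_{V\in T}$ in $L$ with $\rho_V^3=1$ for all $V\in T$, and real numbers $\Gamma_V\ge 0$ $(V\in T)$ with $\sum_{V\in T}\Gamma_V=B$. Let $r_0$ and $k$ be integers with $$r_0>\frac{6+3B}{3B(6B-5)}\quad\text{and}\quad(3B-1)^{k+1}>3r_0+4,$$ and define $$f_1=\frac{2r_0B(3B-1)+B}{3r_0B(6B-5)-6-3B},\qquad f_2=\frac{3r_0B+3}{3r_0B(6B-5)-6-3B},$$ $$g_1=\frac{B-(1-B)(3B-1)\frac{(3B-1)^k-1}{3B-2}}{(3B-1)^{k+1}-3r_0-4},\qquad g_2=\frac{r_0+1+(3B-1)\frac{(3B-1)^k-1}{3B-2}}{(3B-1)^{k+1}-3r_0-4},\qquad g_3=\frac{r_0}{(3B-1)^{k+1}-3r_0-4}.$$ Then there are at most $k$ elements $\zeta\in\mathcal{V}^0$ that satisfy $$\min(1,|1-\rho_V\zeta|_V)\le\Big(\frac{8A}{H(\zeta)^3}\Big)^{\Gamma_V}\quad\text{for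 all }V\in T$$ and $$H(\zeta)>\max\Big((8A)^{f_1}\,24^{f_2},\ (8A)^{g_1}\,48^{g_2}\,2^{-g_3}\Big).$$ -/

import Mathlib

open NumberField

noncomputable section

namespace SUnitPade

/-- The set of places of a number field: archimedean places together with the nonzero primes. -/
abbrev Place (K : Type*) [Field K] [NumberField K] : Type _ :=
  InfinitePlace K ⊕ IsDedekindDomain.HeightOneSpectrum (𝓞 K)

section OneField

variable {K : Type*} [Field K] [NumberField K]

/-- The normalized absolute value `|x|_v`. For archimedean `v` it is
`|σ_v(x)| ^ ([K_v : ℝ] / [K : ℚ])`. For a prime `v` above `p`, the `v`-adic absolute value of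
Mathlib satisfies `|p| = p ^ (-[K_v : ℚ_p])`, and it is raised to the power `1 / [K : ℚ]`. -/
def Place.abv : Place K → K → ℝ
  | Sum.inl w, x => (w x) ^ ((w.mult : ℝ) / (Module.finrank ℚ K : ℝ))
  | Sum.inr P, x => (HeightOneSpectrum.adicAbv K P x) ^ ((1 : ℝ) / (Module.finrank ℚ K : ℝ))

/-- The exponential local height `H_v(β) = max (1, |β|_v)`. -/
def localHeight (v : Place K) (β : K) : ℝ := max 1 (v.abv β)

/-- The exponential absolute height `H(β) = ∏_v H_v(β)`
(all but finitely many factors are `1`). -/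
def height (β : K) : ℝ := ∏ᶠ v : Place K, localHeight v β

/-- `x` is an `S`-unit: `x` is nonzero and `|x|_v = 1` for all places `v` outside `S`. -/
def IsSUnit (S : Finset (Place K)) (x : K) : Prop :=
  x ≠ 0 ∧ ∀ v : Place K, v ∉ S → v.abv x = 1

end OneField

section Extension

variable {K L : Type*} [Field K] [NumberField K] [Field L] [NumberField L] [Algebra K L]

/-- The place of `K` lying below a place of `L`. -/
def Place.below (K : Type*) {L : Type*} [Field K] [NumberField K] [Field L] [NumberField L]
    [Algebra K L] : Place L → Place K
  | Sum.inl w => Sum.inl (w.comap (algebraMap K L))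
  | Sum.inr P => Sum.inr (P.under (𝓞 K))

theorem finite_placesAbove (S : Finset (Place K)) :
    {V : Place L | Place.below K V ∈ S}.Finite := by
  refine Set.Finite.preimage' (f := Place.below K (L := L)) S.finite_toSet ?_
  rintro (w | P) -
  · refine (Set.finite_range (Sum.inl : InfinitePlace L → Place L)).subset ?_
    rintro (V | V) hV
    · exact ⟨V, rfl⟩
    · simp [Place.below] at hV
  · have hmax : P.asIdeal.IsMaximal := P.isMaximal
    have hfin := IsDedekindDomain.primesOver_finite P.asIdeal (𝓞 L)
    have hinj : Function.Injective
        (fun Q : IsDedekindDomain.HeightOneSpectrum (𝓞 L) => Q.asIdeal) :=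
      fun _ _ h => IsDedekindDomain.HeightOneSpectrum.ext h
    refine ((hfin.preimage hinj.injOn).image Sum.inr).subset ?_
    rintro (V | V) hV
    · simp [Place.below] at hV
    · refine ⟨V, ?_, rfl⟩
      have h : V.under (𝓞 K) = P := by simpa [Place.below] using hV
      refine ⟨V.isPrime, ⟨?_⟩⟩
      rw [← h]
      rfl

/-- The finite set `T` of the places of `L` lying above the places in `S`. -/
def placesAbove (L : Type*) [Field L] [NumberField L] [Algebra K L] (S : Finset (Place K)) :
    Finset (Place L) :=
  (finite_placesAbove (L := L) S).toFinset

/-- `ζ(x, y) = ξ(x, y) / η(x, y)` with `ξ = l x - ρ m y` and `η = l x - ρ ^ 2 m y`. -/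
def zeta (ρ : L) (l m x y : K) : L :=
  (algebraMap K L (l * x) - ρ * algebraMap K L (m * y)) /
    (algebraMap K L (l * x) - ρ ^ 2 * algebraMap K L (m * y))

/-- The set `𝒱⁰` of all `ζ(x, y)`, where `x, y` are `S`-units with `l x + m y = 1` such that
`l x / (m y)` is not a root of unity. -/
def V0 (S : Finset (Place K)) (ρ : L) (l m : K) : Set L :=
  {z : L | ∃ x y : K, IsSUnit S x ∧ IsSUnit S y ∧ l * x + m * y = 1 ∧
    ¬ IsOfFinOrder (algebraMap K L (l * x / (m * y))) ∧ z = zeta ρ l m x y}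

/-- `A = (∏_{V ∈ T} |3|_V)^{1/2} ∏_{V ∈ T} |l m|_V (∏_{V ∉ T} max (|l|_V, |m|_V))^3`
(for nonzero `l, m`, all but finitely many factors of the last product are `1`). -/
def constA (L : Type*) [Field L] [NumberField L] [Algebra K L] (S : Finset (Place K))
    (l m : K) : ℝ :=
  (∏ V ∈ placesAbove L S, V.abv (3 : L)) ^ ((1 : ℝ) / 2) *
    (∏ V ∈ placesAbove L S, V.abv (algebraMap K L (l * m))) *
    (∏ᶠ (V : Place L) (_ : V ∉ placesAbove L S),
      max (V.abv (algebraMap K L l)) (V.abv (algebraMap K L m))) ^ 3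

/-- The system of inequalities
`min (1, |1 - ρ_V ζ|_V) ≤ (8 A / H(ζ) ^ 3) ^ Γ_V` for all `V ∈ T`. -/
def SatisfiesSystem (S : Finset (Place K)) (l m : K) (rhoV : Place L → L) (Gam : Place L → ℝ)
    (z : L) : Prop :=
  ∀ V ∈ placesAbove L S,
    min 1 (V.abv (1 - rhoV V * z)) ≤ (8 * constA L S l m / height z ^ 3) ^ Gam V

end Extension

/-- The exponent `f₁(B, r₀)`. -/
def f₁ (B : ℝ) (r : ℤ) : ℝ :=
  (2 * r * B * (3 * B - 1) + B) / (3 * r * B * (6 * B - 5) - 6 - 3 * B)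

/-- The exponent `f₂(B, r₀)`. -/
def f₂ (B : ℝ) (r : ℤ) : ℝ :=
  (3 * r * B + 3) / (3 * r * B * (6 * B - 5) - 6 - 3 * B)

/-- The exponent `g₁(B, k, r₀)`. -/
def g₁ (B : ℝ) (k r : ℤ) : ℝ :=
  (B - (1 - B) * (3 * B - 1) * (((3 * B - 1) ^ k - 1) / (3 * B - 2))) /
    ((3 * B - 1) ^ (k + 1) - 3 * r - 4)

/-- The exponent `g₂(B, k, r₀)`. -/
def g₂ (B : ℝ) (k r : ℤ) : ℝ :=
  (r + 1 + (3 * B - 1) * (((3 * B - 1) ^ k - 1) / (3 * B - 2))) /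
    ((3 * B - 1) ^ (k + 1) - 3 * r - 4)

/-- The exponent `g₃(B, k, r₀)`. -/
def g₃ (B : ℝ) (k r : ℤ) : ℝ :=
  r / ((3 * B - 1) ^ (k + 1) - 3 * r - 4)

end SUnitPade

end

/-! This is a Thue–Siegel argument with explicit Padé approximants to the cube root, run over all
places at once. At each place of `T` every solution is close, in the weighted sense of the system,
to the prescribed cube root of unity `ρ_V⁻¹`, so any two solutions are close to each other. The
product formula turns this into inequalities between heights, and the weights `Γ_V` enter only
through their sum `B`.

Gap principle (`gap_of_mem_V0`). The product formula for `ζ - ζ'` with `H(ζ) ≤ H(ζ')` gives `8A ≤ 48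
H(ζ) H(ζ') (8A / H(ζ)³)^B`. The constant `A` arises from the denominators of `ζ - ζ'` at the places
outside `T`. As `3B - 1 > 1`, logarithmic heights grow geometrically up to additive terms, and among
`k + 1` solutions the lowest height `h₀` and the highest height `h₁` satisfy roughly `h₁ ≥ (3B -
1)^k h₀`.

Padé principle (`pade_of_mem_V0`). There are small integral `P`, `Q` with `P(X³) - X Q(X³)`
divisible by `(1 - X)^(2r+1-g)`. If `a` and `b` are close to the same cube root of unity, then `b
P(a³) - a Q(a³)` is small; when it is nonzero, the product formula bounds the heights. Of two
consecutive approximants at least one gives a nonzero value (`exists_padeApproximants_ne_zero`).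
Sizes are controlled by reading the remainder as a divided difference of `x ↦ X ^ x` over the
exponents `0, 3, …` and `1, 4, …`: its cofactor after removing the power of `X - 1` has nonnegative
coefficients (`exists_dividedDiff_eq`), so its value at `1` bounds it everywhere.

Conclusion (`heights_incompatible`). Take the largest `r` for which `h₁` is still too large for the
term `1 - ρ_V b` to dominate. The other term must then dominate at `r`, while maximality bounds `h₁`
above. Together these contradict the lower bound on `h₀` with exponents `f₁`, `f₂`; the bound with
`g₁`, `g₂`, `g₃` and the gap chain guarantee that such an `r > r₀` exists. -/

namespace SUnitPade

open Polynomial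

/-! ### Divided differences of the exponential `x ↦ X ^ x`. -/

section DividedDifference

/-- The divided difference of `x ↦ X ^ x` at the points of the finite set `S`. -/
noncomputable def dividedDiff (S : Finset ℕ) : ℚ[X] :=
  ∑ x ∈ S, C (∏ y ∈ S.erase x, ((x : ℚ) - y))⁻¹ * X ^ x

theorem prod_erase_sub_ne_zero (S : Finset ℕ) (x : ℕ) :
    (∏ y ∈ S.erase x, ((x : ℚ) - y)) ≠ 0 := by
  refine Finset.prod_ne_zero_iff.2 fun y hy => sub_ne_zero.2 ?_
  exact_mod_cast (Finset.ne_of_mem_erase hy).symm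

/-- Dropping the node `a` multiplies the weight of `x` by `x - a`; this kills the term at `a`, so
the sum may still run over `S`. -/
theorem dividedDiff_erase {S : Finset ℕ} {a : ℕ} (ha : a ∈ S) :
    dividedDiff (S.erase a) =
      ∑ x ∈ S, C ((∏ y ∈ S.erase x, ((x : ℚ) - y))⁻¹ * (x - a)) * X ^ x := by
  rw [dividedDiff, ← Finset.add_sum_erase S _ ha]
  simp only [sub_self, mul_zero, map_zero, zero_mul, zero_add]
  refine Finset.sum_congr rfl fun x hx => ?_
  have hxa : x ≠ a := Finset.ne_of_mem_erase hx
  have h : ((x : ℚ) - a) ≠ 0 := sub_ne_zero.2 (by exact_mod_cast hxa)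
  have hmem : a ∈ S.erase x := Finset.mem_erase.2 ⟨hxa.symm, ha⟩
  rw [← Finset.mul_prod_erase _ _ hmem, Finset.erase_right_comm]
  congr 2
  field_simp

theorem dividedDiff_sub {S : Finset ℕ} {a b : ℕ} (ha : a ∈ S) (hb : b ∈ S) :
    dividedDiff (S.erase a) - dividedDiff (S.erase b) = C ((b : ℚ) - a) * dividedDiff S := by
  rw [dividedDiff_erase ha, dividedDiff_erase hb, ← Finset.sum_sub_distrib, dividedDiff,
    Finset.mul_sum]
  refine Finset.sum_congr rfl fun x _ => ?_
  rw [← sub_mul, ← C_sub, ← mul_assoc, ← C_mul]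
  congr 2
  ring

/-- At consecutive nodes the recursion contributes `X ^ (a + 1) - X ^ a = X ^ a (X - 1)` and a
division by `N + 1` at each step. -/
theorem dividedDiff_Icc (N : ℕ) : ∀ a : ℕ,
    dividedDiff (Finset.Icc a (a + N)) = (X - 1) ^ N * (C ((N.factorial : ℚ)⁻¹) * X ^ a) := by
  induction N with
  | zero => intro a; simp [dividedDiff]
  | succ N ih =>
    intro a
    have h := dividedDiff_sub (S := Finset.Icc a (a + (N + 1))) (a := a) (b := a + (N + 1))
      (by simp) (by simp)
    have h1 : (Finset.Icc a (a + (N + 1))).erase a = Finset.Icc (a + 1) (a + 1 + N) := by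
      ext; simp; omega
    have h2 : (Finset.Icc a (a + (N + 1))).erase (a + (N + 1)) = Finset.Icc a (a + N) := by
      ext; simp; omega
    rw [h1, h2, ih, ih] at h
    have hN : ((N : ℚ) + 1) ≠ 0 := by positivity
    have hC : (C ((N : ℚ) + 1)⁻¹ : ℚ[X]) * C ((N : ℚ) + 1) = 1 := by
      rw [← C_mul, inv_mul_cancel₀ hN, C_1]
    have hcast : ((a + (N + 1) : ℕ) : ℚ) - a = (N : ℚ) + 1 := by push_cast; ring
    rw [hcast] at h
    calc dividedDiff (Finset.Icc a (a + (N + 1)))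
        = C ((N : ℚ) + 1)⁻¹ * (C ((N : ℚ) + 1) * dividedDiff (Finset.Icc a (a + (N + 1)))) := by
          rw [← mul_assoc, hC, one_mul]
      _ = _ := by
          rw [← h, Nat.factorial_succ, Nat.cast_mul, mul_inv, C_mul]
          push_cast
          ring

/-- Divided differences of `x ↦ X ^ x` are divisible by a power of `X - 1`, with a cofactor
that has nonnegative coefficients. -/
theorem exists_dividedDiff_eq (d : ℕ) : ∀ (S : Finset ℕ) (a b N : ℕ), b - a ≤ d →
    S ⊆ Finset.Icc a b → a ∈ S → b ∈ S → S.card = N + 1 →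
    ∃ G : ℚ[X], dividedDiff S = (X - 1) ^ N * G ∧ (∀ i, 0 ≤ G.coeff i) ∧
      G.eval 1 = (N.factorial : ℚ)⁻¹ ∧ G.natDegree + N ≤ b := by
  induction d with
  | zero =>
    intro S a b N hd hS ha hb hN
    have hab : a = b := by have := Finset.mem_Icc.1 (hS ha); omega
    subst hab
    have hSa : S = {a} := by
      simp only [Finset.Icc_self] at hS
      exact (Finset.subset_singleton_iff.1 hS).resolve_left (Finset.ne_empty_of_mem ha)
    subst hSa
    have : N = 0 := by simpa using hN.symm
    subst this
    refine ⟨X ^ a, by simp [dividedDiff], fun i => ?_, by simp, by simp⟩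
    rw [coeff_X_pow]; split_ifs <;> norm_num
  | succ d ih =>
    intro S a b N hd hS ha hb hN
    have hab : a ≤ b := (Finset.mem_Icc.1 (hS ha)).2
    by_cases hcons : S = Finset.Icc a b
    · obtain rfl : b = a + N := by
        rw [hcons, Nat.card_Icc] at hN; omega
      rw [hcons, dividedDiff_Icc]
      refine ⟨_, rfl, fun i => ?_, by simp, ?_⟩
      · rw [coeff_C_mul, coeff_X_pow]; split_ifs <;> simp
      · have := natDegree_C_mul_X_pow_le ((N.factorial : ℚ)⁻¹) a
        omega
    -- Fill a hole `y` of `S`. Eliminating the divided difference of `S ∪ {y}` from two instances of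
    -- the recursion writes that of `S` as a convex combination of those of `S ∪ {y}` without `a`
    -- and without `b`. Both sets have the size of `S` but a smaller spread, so the induction
    -- applies.
    · obtain ⟨y, hy, hyS⟩ : ∃ y ∈ Finset.Icc a b, y ∉ S := by
        by_contra! h
        exact hcons (Finset.Subset.antisymm hS h)
      have hya : y ≠ a := fun h => hyS (h ▸ ha)
      have hyb : y ≠ b := fun h => hyS (h ▸ hb)
      have hy' := Finset.mem_Icc.1 hy
      have hlt : a < y ∧ y < b := by omega
      have step : ∀ c ∈ S, ∀ a' b' : ℕ, b' - a' ≤ d → b' ≤ b →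
          (insert y S).erase c ⊆ Finset.Icc a' b' → a' ∈ (insert y S).erase c →
          b' ∈ (insert y S).erase c →
          ∃ G : ℚ[X], dividedDiff ((insert y S).erase c) = (X - 1) ^ N * G ∧
            (∀ i, 0 ≤ G.coeff i) ∧ G.eval 1 = (N.factorial : ℚ)⁻¹ ∧ G.natDegree + N ≤ b := by
        intro c hc a' b' h1 h2 h3 h4 h5
        obtain ⟨G, g1, g2, g3, g4⟩ := ih _ a' b' N h1 h3 h4 h5 (by
          rw [Finset.card_erase_of_mem (Finset.mem_insert_of_mem hc),
            Finset.card_insert_of_notMem hyS, hN]; rfl)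
        exact ⟨G, g1, g2, g3, g4.trans h2⟩
      have hne1 : ((insert y S).erase a).Nonempty := ⟨y, by simp [hya]⟩
      have hne2 : ((insert y S).erase b).Nonempty := ⟨y, by simp [hyb]⟩
      have hbd : ∀ x ∈ insert y S, a ≤ x ∧ x ≤ b := by
        intro x hx
        rcases Finset.mem_insert.1 hx with rfl | hx
        · omega
        · exact Finset.mem_Icc.1 (hS hx)
      have hmin := Finset.min'_mem _ hne1
      have hmax := Finset.max'_mem _ hne2
      obtain ⟨G₁, e₁, c₁, v₁, d₁⟩ := step a ha (((insert y S).erase a).min' hne1) b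
        (by
          have h1 := hbd _ (Finset.mem_of_mem_erase hmin)
          have h2 := Finset.ne_of_mem_erase hmin
          omega) le_rfl
        (fun x hx => Finset.mem_Icc.2
          ⟨Finset.min'_le _ _ hx, (hbd x (Finset.mem_of_mem_erase hx)).2⟩)
        hmin (by simp [hb]; omega)
      obtain ⟨G₂, e₂, c₂, v₂, d₂⟩ := step b hb a (((insert y S).erase b).max' hne2)
        (by
          have h1 := hbd _ (Finset.mem_of_mem_erase hmax)
          have h2 := Finset.ne_of_mem_erase hmax
          omega) (hbd _ (Finset.mem_of_mem_erase hmax)).2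
        (fun x hx => Finset.mem_Icc.2
          ⟨(hbd x (Finset.mem_of_mem_erase hx)).1, Finset.le_max' _ _ hx⟩)
        (by simp [ha]; omega) hmax
      have hyI : y ∈ insert y S := Finset.mem_insert_self _ _
      have r1 := dividedDiff_sub (Finset.mem_insert_of_mem ha : a ∈ insert y S) hyI
      have r2 := dividedDiff_sub hyI (Finset.mem_insert_of_mem hb : b ∈ insert y S)
      rw [Finset.erase_insert hyS, e₁] at r1
      rw [Finset.erase_insert hyS, e₂] at r2
      have hab' : (0 : ℚ) < (b : ℚ) - a := by
        have : (a : ℚ) < b := by exact_mod_cast hlt.1.trans hlt.2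
        linarith
      have hu : (0 : ℚ) ≤ ((b : ℚ) - y) / (b - a) := by
        have : (y : ℚ) < b := by exact_mod_cast hlt.2
        exact div_nonneg (by linarith) hab'.le
      have hv : (0 : ℚ) ≤ ((y : ℚ) - a) / (b - a) := by
        have : (a : ℚ) < y := by exact_mod_cast hlt.1
        exact div_nonneg (by linarith) hab'.le
      have huv : ((b : ℚ) - y) / (b - a) + ((y : ℚ) - a) / (b - a) = 1 := by
        field_simp
        ring
      refine ⟨C (((b : ℚ) - y) / (b - a)) * G₁ + C (((y : ℚ) - a) / (b - a)) * G₂, ?_, ?_, ?_, ?_⟩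
      · have hC : (C ((b : ℚ) - a)⁻¹ : ℚ[X]) * C ((b : ℚ) - a) = 1 := by
          rw [← C_mul, inv_mul_cancel₀ hab'.ne', C_1]
        have key : C ((b : ℚ) - a) * dividedDiff S =
            (X - 1) ^ N * (C ((b : ℚ) - y) * G₁ + C ((y : ℚ) - a) * G₂) := by
          simp only [C_sub] at r1 r2 ⊢
          linear_combination (-(C (b : ℚ)) + C (y : ℚ)) * r1 + (C (y : ℚ) - C (a : ℚ)) * r2
        calc dividedDiff S = C ((b : ℚ) - a)⁻¹ * (C ((b : ℚ) - a) * dividedDiff S) := by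
              rw [← mul_assoc, hC, one_mul]
          _ = _ := by
              rw [key, div_eq_mul_inv, div_eq_mul_inv, C_mul, C_mul]
              ring
      · intro i
        rw [coeff_add, coeff_C_mul, coeff_C_mul]
        exact add_nonneg (mul_nonneg hu (c₁ i)) (mul_nonneg hv (c₂ i))
      · simp only [eval_add, eval_mul, eval_C, v₁, v₂]
        rw [← add_mul, huv, one_mul]
      · have h1 := natDegree_C_mul_le (((b : ℚ) - y) / (b - a)) G₁
        have h2 := natDegree_C_mul_le (((y : ℚ) - a) / (b - a)) G₂
        have h3 := natDegree_add_le (C (((b : ℚ) - y) / (b - a)) * G₁)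
          (C (((y : ℚ) - a) / (b - a)) * G₂)
        omega

end DividedDifference

/-! ### Padé coefficients: closed form, sum and denominators. -/

section PadeCoefficients

theorem prod_range_const_mul {R : Type*} [CommMonoid R] (c : R) (f : ℕ → R) (k : ℕ) :
    ∏ j ∈ Finset.range k, c * f j = c ^ k * ∏ j ∈ Finset.range k, f j := by
  simp [Finset.prod_mul_distrib]

/-- The falling factorial `x (x - 1) ⋯ (x - k + 1)`. -/
def fallingFactorial (x : ℚ) (k : ℕ) : ℚ := ∏ j ∈ Finset.range k, (x - j)

theorem fallingFactorial_add (x : ℚ) (a b : ℕ) :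
    fallingFactorial x (a + b) = fallingFactorial x a * fallingFactorial (x - a) b := by
  rw [fallingFactorial, Finset.prod_range_add, fallingFactorial, fallingFactorial]
  congr 1
  refine Finset.prod_congr rfl fun j _ => ?_
  push_cast; ring

theorem fallingFactorial_neg (x : ℚ) (d : ℕ) :
    fallingFactorial (-x) d = (-1) ^ d * fallingFactorial (x + d - 1) d := by
  have h : fallingFactorial (x + d - 1) d = ∏ j ∈ Finset.range d, (x + j) := by
    rw [fallingFactorial, ← Finset.prod_range_reflect]
    refine Finset.prod_congr rfl fun j hj => ?_
    have hj := Finset.mem_range.1 hj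
    have : ((d - 1 - j : ℕ) : ℚ) = d - 1 - j := by
      rw [Nat.cast_sub (by omega), Nat.cast_sub (by omega)]; simp
    rw [this]; ring
  rw [h, fallingFactorial, ← prod_range_const_mul]
  exact Finset.prod_congr rfl fun j _ => by ring

theorem fallingFactorial_self (k : ℕ) : fallingFactorial k k = k.factorial := by
  induction k with
  | zero => simp [fallingFactorial]
  | succ k ih =>
    rw [add_comm, fallingFactorial_add, Nat.cast_add, Nat.cast_one, add_sub_cancel_left, ih,
      add_comm 1 k, Nat.factorial_succ]
    simp [fallingFactorial, add_comm]

theorem fallingFactorial_eq_factorial_mul_choose (x : ℚ) (k : ℕ) :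
    fallingFactorial x k = k.factorial * Ring.choose x k := by
  have h := Ring.descPochhammer_eq_factorial_smul_choose x k
  rw [nsmul_eq_mul] at h
  rw [← h, fallingFactorial, ← descPochhammer_eval_eq_prod_range,
    ← descPochhammer_map (Int.castRingHom ℚ), eval_map, ← eval₂_smulOneHom_eq_smeval]
  congr 1
  ext; simp

theorem choose_nonneg {x : ℚ} {k : ℕ} (h : (k : ℚ) < x + 1) : 0 ≤ Ring.choose x k := by
  have h1 : 0 ≤ fallingFactorial x k := by
    refine Finset.prod_nonneg fun j hj => ?_
    have : (j : ℚ) + 1 ≤ k := by exact_mod_cast Finset.mem_range.1 hj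
    linarith
  rw [fallingFactorial_eq_factorial_mul_choose] at h1
  exact nonneg_of_mul_nonneg_right h1 (by positivity)

theorem choose_ne_zero {x : ℚ} {k : ℕ} (h : ∀ j : ℕ, x ≠ j) : Ring.choose x k ≠ 0 := by
  have h1 : fallingFactorial x k ≠ 0 :=
    Finset.prod_ne_zero_iff.2 fun j _ => sub_ne_zero.2 (h j)
  rw [fallingFactorial_eq_factorial_mul_choose] at h1
  exact right_ne_zero_of_mul h1

theorem prod_range_erase_sub (n k : ℕ) (hk : k ≤ n) :
    ∏ j ∈ (Finset.range (n + 1)).erase k, ((k : ℚ) - j) =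
      (-1) ^ (n - k) * k.factorial * (n - k).factorial := by
  obtain ⟨d, rfl⟩ := Nat.exists_eq_add_of_le hk
  have h1 : ∏ j ∈ (Finset.range (k + d + 1)).erase k, ((k : ℚ) - j) =
      ∏ j ∈ Finset.range (k + (1 + d)), if j = k then 1 else ((k : ℚ) - j) := by
    rw [show k + (1 + d) = k + d + 1 by ring, ← Finset.mul_prod_erase (Finset.range (k + d + 1)) _
      (Finset.mem_range.2 (by omega : k < k + d + 1)), if_pos rfl, one_mul]
    exact Finset.prod_congr rfl fun j hj => (if_neg (Finset.ne_of_mem_erase hj)).symm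
  have h2 : ∏ j ∈ Finset.range k, (if j = k then 1 else ((k : ℚ) - j)) = k.factorial := by
    rw [← fallingFactorial_self]
    exact Finset.prod_congr rfl fun j hj => if_neg (Finset.mem_range.1 hj).ne
  have h3 : ∏ i ∈ Finset.range d, (if k + (1 + i) = k then 1 else ((k : ℚ) - (k + (1 + i) : ℕ))) =
      (-1) ^ d * d.factorial := by
    have := fallingFactorial_neg 1 d
    rw [show (1 : ℚ) + d - 1 = d by ring, fallingFactorial_self] at this
    rw [← this]
    refine Finset.prod_congr rfl fun j _ => ?_
    rw [if_neg (by omega)]; push_cast; ring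
  rw [h1, Finset.prod_range_add, h2, Finset.prod_range_add, h3]
  simp
  ring

/-- The coefficients of the Padé approximants to the power function with exponent `δ`. -/
noncomputable def padeCoeff (δ : ℚ) (n m k : ℕ) : ℚ := Ring.choose (m + δ) k * Ring.choose (n - δ) (n - k)

/-- The two products on the left form the divided-difference denominator at the node `k` for the
nodes `0, …, n` and `δ, …, δ + m`. The right side is independent of `k`, so the Padé coefficients
are divided-difference weights up to a common constant. -/
theorem prod_mul_padeCoeff (δ : ℚ) {n m k : ℕ} (hkn : k ≤ n) (hkm : k ≤ m + 1) :
    (∏ j ∈ (Finset.range (n + 1)).erase k, ((k : ℚ) - j)) * fallingFactorial (k - δ) (m + 1) *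
      padeCoeff δ n m k =
    (-1) ^ (n + m + 1) * (fallingFactorial (n - δ) n * fallingFactorial (m + δ) (m + 1)) := by
  rw [prod_range_erase_sub n k hkn]
  obtain ⟨d, rfl⟩ := Nat.exists_eq_add_of_le hkn
  obtain ⟨e, he⟩ := Nat.exists_eq_add_of_le hkm
  have he' : (m : ℚ) + 1 = k + e := by exact_mod_cast he
  have c1 := fallingFactorial_eq_factorial_mul_choose (m + δ) k
  have c2 := fallingFactorial_eq_factorial_mul_choose ((k + d : ℕ) - δ) d
  have a1 : fallingFactorial (k - δ) (m + 1) =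
      fallingFactorial (k - δ) k * ((-1) ^ e * fallingFactorial (m + δ - k) e) := by
    rw [he, fallingFactorial_add, show (k : ℚ) - δ - k = -δ by ring, fallingFactorial_neg,
      show δ + e - 1 = m + δ - k by linarith]
  have a2 : fallingFactorial (m + δ) (m + 1) =
      fallingFactorial (m + δ) k * fallingFactorial (m + δ - k) e := by
    rw [he, fallingFactorial_add]
  have a3 : fallingFactorial ((k + d : ℕ) - δ) (k + d) =
      fallingFactorial ((k + d : ℕ) - δ) d * fallingFactorial (k - δ) k := by
    rw [add_comm k d, fallingFactorial_add]
    congr 2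
    push_cast; ring
  have hs : ((-1 : ℚ)) ^ (k + d + m + 1) = (-1) ^ d * (-1) ^ e := by
    rw [show k + d + m + 1 = d + e + 2 * k by omega, pow_add, pow_add, pow_mul]; simp
  rw [a1, a2, a3, c1, c2, hs, padeCoeff, Nat.add_sub_cancel_left]
  ring

theorem padeCoeff_nonneg {δ : ℚ} {n m k : ℕ} (hδ : |δ| < 1) (hkn : k ≤ n)
    (hkm : (k : ℚ) < m + δ + 1) : 0 ≤ padeCoeff δ n m k := by
  have h1 := abs_lt.1 hδ
  refine mul_nonneg (choose_nonneg hkm) (choose_nonneg ?_)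
  rw [Nat.cast_sub hkn]
  have : (0 : ℚ) ≤ k := k.cast_nonneg
  linarith [h1.2]

/-- Chu–Vandermonde; the shift `δ` cancels in `(m + δ) + (n - δ)`. -/
theorem sum_padeCoeff (δ : ℚ) (n m : ℕ) :
    ∑ k ∈ Finset.range (n + 1), padeCoeff δ n m k = (n + m).choose n := by
  have h := Ring.add_choose_eq (r := (m : ℚ) + δ) (s := n - δ) n (Commute.all _ _)
  rw [Finset.Nat.sum_antidiagonal_eq_sum_range_succ
    (fun i j => Ring.choose ((m : ℚ) + δ) i * Ring.choose ((n : ℚ) - δ) j)] at h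
  rw [show ((m : ℚ) + δ) + (n - δ) = ((n + m : ℕ) : ℚ) by push_cast; ring,
    Ring.choose_natCast] at h
  exact h.symm

/-- As `3` is invertible modulo `M`, write `a ≡ 3 b`. The product becomes `3 ^ k` times `k`
consecutive integers, which is divisible by `k!`. -/
theorem dvd_prod_of_coprime {M k : ℕ} (h3 : Nat.Coprime 3 M) (hM : M ∣ k.factorial) (a : ℤ) :
    (M : ℤ) ∣ ∏ j ∈ Finset.range k, (a - 3 * j) := by
  obtain ⟨b, hb⟩ : ∃ b : ℤ, (M : ℤ) ∣ a - 3 * b := by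
    obtain ⟨u, v, huv⟩ := Nat.isCoprime_iff_coprime.2 h3
    refine ⟨u * a, v * a, ?_⟩
    push_cast at huv ⊢
    linear_combination -a * huv
  have h1 : ∏ j ∈ Finset.range k, (3 * b - 3 * (j : ℤ)) ≡
      ∏ j ∈ Finset.range k, (a - 3 * j) [ZMOD M] := by
    refine Int.ModEq.prod fun j _ => ?_
    exact Int.ModEq.sub_right _ ((Int.modEq_iff_dvd).2 hb)
  refine (Int.ModEq.dvd_iff h1).1 ?_
  have h2 : ∏ j ∈ Finset.range k, (3 * b - 3 * (j : ℤ)) =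
      3 ^ k * ∏ j ∈ Finset.range k, (b - j) := by
    rw [← prod_range_const_mul]
    exact Finset.prod_congr rfl fun j _ => by ring
  rw [h2]
  refine Dvd.dvd.mul_left (dvd_trans (Int.natCast_dvd_natCast.2 hM) ?_) _
  rw [← descPochhammer_eval_eq_prod_range]
  have := Ring.descPochhammer_eq_factorial_smul_choose b k
  rw [nsmul_eq_mul, ← aeval_eq_smeval, coe_aeval_eq_eval] at this
  exact ⟨_, this⟩

/-- The part of `k!` prime to `3` cancels against the numerator. What remains is `3 ^ k` from the
denominators of the factors and the power of `3` in `k!`. -/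
theorem exists_int_eq_three_pow_mul_choose (a : ℤ) (k : ℕ) :
    ∃ z : ℤ, (3 : ℚ) ^ (k + padicValNat 3 k.factorial) * Ring.choose ((a : ℚ) / 3) k = z := by
  have hk := k.factorial_ne_zero
  obtain ⟨M, hM⟩ : 3 ^ padicValNat 3 k.factorial ∣ k.factorial := pow_padicValNat_dvd
  have h3 : Nat.Coprime 3 M := by
    rw [Nat.Prime.coprime_iff_not_dvd Nat.prime_three]
    rintro ⟨c, rfl⟩
    refine pow_succ_padicValNat_not_dvd (p := 3) hk ?_
    exact ⟨c, by rw [pow_succ, mul_assoc]; exact hM⟩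
  obtain ⟨z, hz⟩ := dvd_prod_of_coprime h3 ⟨_, by rw [mul_comm]; exact hM⟩ a
  refine ⟨z, ?_⟩
  have h1 := fallingFactorial_eq_factorial_mul_choose ((a : ℚ) / 3) k
  have h2 : (3 : ℚ) ^ k * fallingFactorial ((a : ℚ) / 3) k = M * z := by
    have hz' : ((∏ j ∈ Finset.range k, (a - 3 * j) : ℤ) : ℚ) = M * z := by
      rw [hz]; push_cast; ring
    rw [← hz', fallingFactorial, ← prod_range_const_mul]
    push_cast
    exact Finset.prod_congr rfl fun j _ => by ring
  have hM0 : (M : ℚ) ≠ 0 := by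
    rintro h
    rw [Nat.cast_eq_zero.1 h, mul_zero] at hM
    exact hk hM
  have hM' : (k.factorial : ℚ) = 3 ^ padicValNat 3 k.factorial * M := by exact_mod_cast hM
  rw [h1] at h2
  apply mul_left_cancel₀ hM0
  rw [← h2]
  rw [pow_add]
  linear_combination (-(3 : ℚ) ^ k * Ring.choose ((a : ℚ) / 3) k) * hM'

/-- A power of `3` that clears the denominators of the Padé approximants of degree `n`. -/
def padeDenom (n : ℕ) : ℕ := 3 ^ (n + padicValNat 3 n.factorial)

theorem padeDenom_pos (n : ℕ) : 0 < padeDenom n := by unfold padeDenom; positivity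

/-- Legendre's formula gives `2 v₃(n!) ≤ n`, and `3 ≤ 2 ^ 2`. -/
theorem padeDenom_le (n : ℕ) : padeDenom n ≤ 6 ^ n := by
  have h := sub_one_mul_padicValNat_factorial (p := 3) n
  have h1 : 2 * padicValNat 3 n.factorial ≤ n := by omega
  calc padeDenom n = 3 ^ n * 3 ^ padicValNat 3 n.factorial := pow_add _ _ _
    _ ≤ 3 ^ n * 4 ^ padicValNat 3 n.factorial := by gcongr; norm_num
    _ = 3 ^ n * 2 ^ (2 * padicValNat 3 n.factorial) := by rw [pow_mul]; norm_num
    _ ≤ 3 ^ n * 2 ^ n := by gcongr; norm_num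
    _ = 6 ^ n := by rw [← mul_pow]; norm_num

/-- Since `i! j!` divides `n!`, the powers of `3` needed for the two factors together do not exceed
the one for `n`. -/
theorem exists_int_eq_padeDenom_mul (a b : ℤ) {i j n : ℕ} (h : i + j ≤ n) :
    ∃ z : ℤ, (padeDenom n : ℚ) * (Ring.choose ((a : ℚ) / 3) i * Ring.choose ((b : ℚ) / 3) j)
      = z := by
  obtain ⟨z₁, h₁⟩ := exists_int_eq_three_pow_mul_choose a i
  obtain ⟨z₂, h₂⟩ := exists_int_eq_three_pow_mul_choose b j
  have hv : padicValNat 3 i.factorial + padicValNat 3 j.factorial ≤ padicValNat 3 n.factorial := by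
    rw [← padicValNat.mul i.factorial_ne_zero j.factorial_ne_zero]
    refine padicValNat_dvd_iff_le (n.factorial_ne_zero) |>.1 ?_
    exact pow_padicValNat_dvd.trans ((Nat.factorial_mul_factorial_dvd_factorial_add i j).trans
      (Nat.factorial_dvd_factorial h))
  obtain ⟨c, hc⟩ := Nat.exists_eq_add_of_le
    (add_le_add h hv : (i + j) + (padicValNat 3 i.factorial + padicValNat 3 j.factorial) ≤
      n + padicValNat 3 n.factorial)
  refine ⟨3 ^ c * z₁ * z₂, ?_⟩
  rw [padeDenom, hc]
  push_cast
  rw [← h₁, ← h₂]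
  ring

end PadeCoefficients

/-! ### Integral Padé approximants to the cube root. -/

section PadeApproximants

/-- The Padé approximant with coefficients `padeCoeff δ n m k`. -/
noncomputable def padePoly (δ : ℚ) (n m : ℕ) : ℚ[X] :=
  ∑ k ∈ Finset.range (n + 1), C (padeCoeff δ n m k) * X ^ k

theorem coeff_padePoly (δ : ℚ) (n m k : ℕ) :
    (padePoly δ n m).coeff k = if k ≤ n then padeCoeff δ n m k else 0 := by
  simp only [padePoly, finsetSum_coeff, coeff_C_mul_X_pow]
  rw [Finset.sum_ite_eq]
  simp

theorem eval_one_padePoly (δ : ℚ) (n m : ℕ) :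
    (padePoly δ n m).eval 1 = (n + m).choose n := by
  rw [← sum_padeCoeff δ, padePoly, eval_finsetSum]
  simp

/-- The exponents `0, 3, …, 3 n` and `1, 4, …, 3 m + 1`. -/
def padeExponents (n m : ℕ) : Finset ℕ :=
  (Finset.range (n + 1)).image (fun k => 3 * k) ∪
    (Finset.range (m + 1)).image (fun k => 3 * k + 1)

theorem disjoint_image_exponents (s t : Finset ℕ) :
    Disjoint (s.image (fun k => 3 * k)) (t.image (fun k => 3 * k + 1)) := by
  rw [Finset.disjoint_left]
  intro x hx hy
  obtain ⟨a, -, rfl⟩ := Finset.mem_image.1 hx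
  obtain ⟨b, -, hb⟩ := Finset.mem_image.1 hy
  omega

theorem card_padeExponents (n m : ℕ) : (padeExponents n m).card = n + m + 1 + 1 := by
  rw [padeExponents, Finset.card_union_of_disjoint (disjoint_image_exponents _ _),
    Finset.card_image_of_injective _ (fun a b h => by simpa using h),
    Finset.card_image_of_injective _ (fun a b h => by simpa using h)]
  simp; ring

theorem prod_erase_padeExponents_left {n m k : ℕ} :
    ∏ y ∈ (padeExponents n m).erase (3 * k), (((3 * k : ℕ) : ℚ) - y) =
      (∏ j ∈ (Finset.range (n + 1)).erase k, (3 * ((k : ℚ) - j))) *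
        (3 ^ (m + 1) * fallingFactorial (k - 1 / 3) (m + 1)) := by
  have h : (padeExponents n m).erase (3 * k) =
      ((Finset.range (n + 1)).erase k).image (fun k => 3 * k) ∪
        (Finset.range (m + 1)).image (fun k => 3 * k + 1) := by
    ext x
    simp only [padeExponents, Finset.mem_erase, Finset.mem_union, Finset.mem_image]
    constructor
    · rintro ⟨h1, ⟨a, ha, rfl⟩ | ⟨a, ha, rfl⟩⟩
      · exact Or.inl ⟨a, ⟨fun h => h1 (by rw [h]), ha⟩, rfl⟩
      · exact Or.inr ⟨a, ha, rfl⟩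
    · rintro (⟨a, ⟨h1, ha⟩, rfl⟩ | ⟨a, ha, rfl⟩)
      · exact ⟨by omega, Or.inl ⟨a, ha, rfl⟩⟩
      · exact ⟨by omega, Or.inr ⟨a, ha, rfl⟩⟩
  rw [h, Finset.prod_union (disjoint_image_exponents _ _),
    Finset.prod_image (fun a _ b _ h => by simpa using h),
    Finset.prod_image (fun a _ b _ h => by simpa using h), fallingFactorial,
    ← prod_range_const_mul]
  congr 1
  · exact Finset.prod_congr rfl fun j _ => by push_cast; ring
  · exact Finset.prod_congr rfl fun j _ => by push_cast; ring

theorem prod_erase_padeExponents_right {n m k : ℕ} :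
    ∏ y ∈ (padeExponents n m).erase (3 * k + 1), (((3 * k + 1 : ℕ) : ℚ) - y) =
      (∏ j ∈ (Finset.range (m + 1)).erase k, (3 * ((k : ℚ) - j))) *
        (3 ^ (n + 1) * fallingFactorial (k - (-1 / 3)) (n + 1)) := by
  have h : (padeExponents n m).erase (3 * k + 1) =
      ((Finset.range (n + 1))).image (fun k => 3 * k) ∪
        ((Finset.range (m + 1)).erase k).image (fun k => 3 * k + 1) := by
    ext x
    simp only [padeExponents, Finset.mem_erase, Finset.mem_union, Finset.mem_image]
    constructor
    · rintro ⟨h1, ⟨a, ha, rfl⟩ | ⟨a, ha, rfl⟩⟩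
      · exact Or.inl ⟨a, ha, rfl⟩
      · exact Or.inr ⟨a, ⟨fun h => h1 (by rw [h]), ha⟩, rfl⟩
    · rintro (⟨a, ha, rfl⟩ | ⟨a, ⟨h1, ha⟩, rfl⟩)
      · exact ⟨by omega, Or.inl ⟨a, ha, rfl⟩⟩
      · exact ⟨by omega, Or.inr ⟨a, ha, rfl⟩⟩
  rw [h, Finset.prod_union (disjoint_image_exponents _ _),
    Finset.prod_image (fun a _ b _ h => by simpa using h),
    Finset.prod_image (fun a _ b _ h => by simpa using h), fallingFactorial,
    ← prod_range_const_mul, mul_comm]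
  congr 1
  · exact Finset.prod_congr rfl fun j _ => by push_cast; ring
  · exact Finset.prod_congr rfl fun j _ => by push_cast; ring

/-- The normalizing factor between Padé remainders and divided differences. -/
def padeConst (n m : ℕ) : ℚ :=
  3 ^ (n + m + 1) * (fallingFactorial (n - 1 / 3) n * fallingFactorial (m + 1 / 3) (m + 1))

theorem prod_erase_const_mul {n k : ℕ} (hk : k ≤ n) (f : ℕ → ℚ) :
    ∏ j ∈ (Finset.range (n + 1)).erase k, (3 * f j) =
      3 ^ n * ∏ j ∈ (Finset.range (n + 1)).erase k, f j := by
  rw [Finset.prod_mul_distrib, Finset.prod_const,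
    Finset.card_erase_of_mem (Finset.mem_range.2 (by omega)), Finset.card_range,
    Nat.add_sub_cancel]

/-- The exponents `3k` and `3k + 1` are three times the nodes `k` and `k + 1/3`, so
`prod_mul_padeCoeff` with `δ = 1/3` and `δ = -1/3` identifies both families of coefficients with
divided-difference weights. -/
theorem padePoly_comp_sub {n m : ℕ} (hnm : n ≤ m + 1) (hmn : m ≤ n) :
    (padePoly (1 / 3) n m).comp (X ^ 3) - X * (padePoly (-1 / 3) m n).comp (X ^ 3) =
      C ((-1) ^ (n + m + 1) * padeConst n m) * dividedDiff (padeExponents n m) := by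
  have hE := fun x => prod_erase_sub_ne_zero (padeExponents n m) x
  rw [dividedDiff, Finset.mul_sum, padeExponents,
    Finset.sum_union (disjoint_image_exponents _ _),
    Finset.sum_image (fun a _ b _ h => by simpa using h),
    Finset.sum_image (fun a _ b _ h => by simpa using h), ← padeExponents, sub_eq_add_neg]
  congr 1
  · simp only [padePoly, comp, eval₂_finsetSum, eval₂_mul, eval₂_C, eval₂_X_pow]
    refine Finset.sum_congr rfl fun k hk => ?_
    have hk := Nat.lt_succ_iff.1 (Finset.mem_range.1 hk)
    rw [← mul_assoc, ← C_mul, pow_mul]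
    congr 2
    have h := prod_mul_padeCoeff (1 / 3) hk (hk.trans hnm)
    rw [eq_mul_inv_iff_mul_eq₀ (hE _), prod_erase_padeExponents_left, prod_erase_const_mul hk,
      padeConst]
    linear_combination (3 : ℚ) ^ n * 3 ^ (m + 1) * h
  · simp only [padePoly, comp, eval₂_finsetSum, eval₂_mul, eval₂_C, eval₂_X_pow, Finset.mul_sum,
      ← Finset.sum_neg_distrib]
    refine Finset.sum_congr rfl fun k hk => ?_
    have hk := Nat.lt_succ_iff.1 (Finset.mem_range.1 hk)
    have key : (-1) ^ (n + m + 1) * padeConst n m * (∏ y ∈ (padeExponents n m).erase (3 * k + 1),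
        (((3 * k + 1 : ℕ) : ℚ) - y))⁻¹ = -padeCoeff (-1 / 3) m n k := by
      have h := prod_mul_padeCoeff (-1 / 3) hk (hk.trans (hmn.trans n.le_succ))
      rw [eq_comm, eq_mul_inv_iff_mul_eq₀ (hE _), prod_erase_padeExponents_right,
        prod_erase_const_mul hk, padeConst]
      -- The normalizing constants of the two families differ only in the last factors, `-1/3`
      -- against `1/3`. This is the source of the minus sign before `X * Q`.
      have e1 : fallingFactorial ((n : ℚ) - 1 / 3) (n + 1) =
          fallingFactorial (n - 1 / 3) n * (-1 / 3) := by
        rw [fallingFactorial_add]; simp [fallingFactorial]; ring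
      have e2 : fallingFactorial ((m : ℚ) + 1 / 3) (m + 1) =
          fallingFactorial (m + 1 / 3) m * (1 / 3) := by
        rw [fallingFactorial_add]; simp [fallingFactorial]
      rw [show (m : ℚ) - -1 / 3 = m + 1 / 3 by ring,
        show (n : ℚ) + -1 / 3 = n - 1 / 3 by ring, e1] at h
      rw [e2]
      rw [show m + n + 1 = n + m + 1 by ring] at h
      linear_combination (-(3 : ℚ) ^ m * 3 ^ (n + 1)) * h
    have key' := congrArg C key
    rw [C_mul, C_neg] at key'
    linear_combination (-(X : ℚ[X]) ^ (3 * k + 1)) * key'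

theorem padeConst_eq (n m : ℕ) : padeConst n m =
    (((∏ j ∈ Finset.range n, (3 * j + 2)) * ∏ j ∈ Finset.range (m + 1), (3 * j + 1) : ℕ) : ℚ) := by
  have h1 : (3 : ℚ) ^ n * fallingFactorial (n - 1 / 3) n =
      ((∏ j ∈ Finset.range n, (3 * j + 2) : ℕ) : ℚ) := by
    rw [fallingFactorial, ← prod_range_const_mul, ← Finset.prod_range_reflect]
    push_cast
    refine Finset.prod_congr rfl fun j hj => ?_
    have hj := Finset.mem_range.1 hj
    rw [Nat.cast_sub (by omega), Nat.cast_sub (by omega)]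
    push_cast; ring
  have h2 : (3 : ℚ) ^ (m + 1) * fallingFactorial (m + 1 / 3) (m + 1) =
      ((∏ j ∈ Finset.range (m + 1), (3 * j + 1) : ℕ) : ℚ) := by
    rw [fallingFactorial, ← prod_range_const_mul, ← Finset.prod_range_reflect]
    push_cast
    refine Finset.prod_congr rfl fun j hj => ?_
    have hj := Finset.mem_range.1 hj
    rw [Nat.cast_sub (by omega)]
    ring
  rw [Nat.cast_mul, ← h1, ← h2, padeConst]
  ring

/-- Raising `n` multiplies the left side by `(3n+2)(3n+4)` and the factorial by `(2n+2)(2n+3)`, so a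
factor `4` per step is ample. The primed version treats `m + 1 = n`. -/
theorem prod_le_four_pow_mul_factorial (n : ℕ) :
    (∏ j ∈ Finset.range n, (3 * j + 2)) * ∏ j ∈ Finset.range (n + 1), (3 * j + 1) ≤
      4 ^ n * (2 * n + 1).factorial := by
  induction n with
  | zero => simp
  | succ n ih =>
    rw [Finset.prod_range_succ, Finset.prod_range_succ _ (n + 1)]
    have h1 : (2 * (n + 1) + 1).factorial =
        (2 * n + 3) * ((2 * n + 2) * (2 * n + 1).factorial) := by
      rw [show 2 * (n + 1) + 1 = 2 * n + 1 + 1 + 1 by ring, Nat.factorial_succ,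
        Nat.factorial_succ]
    have h2 : (3 * n + 2) * (3 * (n + 1) + 1) ≤ 4 * ((2 * n + 3) * (2 * n + 2)) := by nlinarith
    calc _ = ((∏ j ∈ Finset.range n, (3 * j + 2)) * ∏ j ∈ Finset.range (n + 1), (3 * j + 1)) *
          ((3 * n + 2) * (3 * (n + 1) + 1)) := by ring
      _ ≤ (4 ^ n * (2 * n + 1).factorial) * (4 * ((2 * n + 3) * (2 * n + 2))) :=
          Nat.mul_le_mul ih h2
      _ = _ := by rw [h1]; ring

theorem prod_le_four_pow_mul_factorial' (m : ℕ) :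
    (∏ j ∈ Finset.range (m + 1), (3 * j + 2)) * ∏ j ∈ Finset.range (m + 1), (3 * j + 1) ≤
      4 ^ (m + 1) * (2 * m + 2).factorial := by
  induction m with
  | zero => simp [Nat.factorial]
  | succ n ih =>
    rw [Finset.prod_range_succ, Finset.prod_range_succ _ (n + 1)]
    have h1 : (2 * (n + 1) + 2).factorial =
        (2 * n + 4) * ((2 * n + 3) * (2 * n + 2).factorial) := by
      rw [show 2 * (n + 1) + 2 = 2 * n + 2 + 1 + 1 by ring, Nat.factorial_succ,
        Nat.factorial_succ]
    have h2 : (3 * (n + 1) + 2) * (3 * (n + 1) + 1) ≤ 4 * ((2 * n + 4) * (2 * n + 3)) := by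
      nlinarith
    calc _ = ((∏ j ∈ Finset.range (n + 1), (3 * j + 2)) *
            ∏ j ∈ Finset.range (n + 1), (3 * j + 1)) *
          ((3 * (n + 1) + 2) * (3 * (n + 1) + 1)) := by ring
      _ ≤ (4 ^ (n + 1) * (2 * n + 2).factorial) * (4 * ((2 * n + 4) * (2 * n + 3))) :=
          Nat.mul_le_mul ih h2
      _ = _ := by rw [h1]; ring

theorem padeConst_le {n m : ℕ} (h : m = n ∨ m + 1 = n) :
    padeConst n m ≤ 4 ^ n * (n + m + 1).factorial := by
  rw [padeConst_eq]
  rcases h with rfl | rfl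
  · rw [show m + m + 1 = 2 * m + 1 by ring]
    exact_mod_cast prod_le_four_pow_mul_factorial m
  · rw [show m + 1 + m + 1 = 2 * m + 2 by ring]
    exact_mod_cast prod_le_four_pow_mul_factorial' m

/-- An integer polynomial with nonnegative coefficients, bounded degree and bounded sum of
coefficients. -/
structure IsSmall (p : ℤ[X]) (d B : ℕ) : Prop where
  coeff_nonneg : ∀ i, 0 ≤ p.coeff i
  natDegree_le : p.natDegree ≤ d
  eval_one_le : p.eval 1 ≤ B

/-- The bound is `24 = 6 · 4`: at most `6 ^ N` for the denominator and `4 ^ N` for the binomial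
coefficient that is the sum of the coefficients. The hypothesis `hδn` keeps the generalized
binomials nonnegative. `N` is separate from the degree so that `P` and `Q` can share one
denominator. -/
theorem exists_int_padePoly {δ : ℚ} {n m N : ℕ} (hδ : δ = 1 / 3 ∨ δ = -1 / 3) (hn : n ≤ N)
    (hm : m ≤ N) (hδn : (n : ℚ) < m + δ + 1) :
    ∃ P : ℤ[X], P.map (Int.castRingHom ℚ) = C (padeDenom N : ℚ) * padePoly δ n m ∧
      IsSmall P n (24 ^ N) := by
  have hint : ∀ k, ∃ z : ℤ, (padeDenom N : ℚ) * (padePoly δ n m).coeff k = z := by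
    intro k
    rw [coeff_padePoly]
    split_ifs with hk
    · rw [padeCoeff]
      rcases hδ with rfl | rfl
      · obtain ⟨z, hz⟩ := exists_int_eq_padeDenom_mul (3 * m + 1) (3 * n - 1)
          (by omega : k + (n - k) ≤ N)
        refine ⟨z, hz ▸ ?_⟩
        push_cast
        congr 3 <;> ring
      · obtain ⟨z, hz⟩ := exists_int_eq_padeDenom_mul (3 * m - 1) (3 * n + 1)
          (by omega : k + (n - k) ≤ N)
        refine ⟨z, hz ▸ ?_⟩
        push_cast
        congr 3 <;> ring
    · exact ⟨0, by simp⟩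
  have hlift : C (padeDenom N : ℚ) * padePoly δ n m ∈ lifts (Int.castRingHom ℚ) := by
    rw [lifts_iff_coeff_lifts]
    intro k
    obtain ⟨z, hz⟩ := hint k
    exact ⟨z, by rw [coeff_C_mul, hz]; simp⟩
  obtain ⟨P, hP⟩ := (mem_lifts _).1 hlift
  have hcoeff : ∀ k, (P.coeff k : ℚ) = padeDenom N * (padePoly δ n m).coeff k := by
    intro k
    rw [← coeff_C_mul, ← hP, coeff_map]; simp
  refine ⟨P, hP, fun k => ?_, ?_, ?_⟩
  · have : (0 : ℚ) ≤ P.coeff k := by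
      rw [hcoeff, coeff_padePoly]
      refine mul_nonneg (Nat.cast_nonneg _) ?_
      split_ifs with hk
      · refine padeCoeff_nonneg ?_ hk (lt_of_le_of_lt (by exact_mod_cast hk) hδn)
        rcases hδ with rfl | rfl <;> norm_num [abs_lt]
      · exact le_rfl
    exact_mod_cast this
  · rw [natDegree_le_iff_coeff_eq_zero]
    intro k hk
    have := hcoeff k
    rw [coeff_padePoly, if_neg (by omega), mul_zero] at this
    exact_mod_cast this
  · have h1 : ((P.eval 1 : ℤ) : ℚ) = padeDenom N * (n + m).choose n := by
      rw [← eval_one_padePoly δ, ← eval_C (x := (1 : ℚ)) (a := (padeDenom N : ℚ)), ← eval_mul,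
        ← hP, eval_one_map]
      simp
    have h2 : (n + m).choose n ≤ 4 ^ N := calc
      (n + m).choose n ≤ 2 ^ (n + m) := Nat.choose_le_two_pow _ _
      _ ≤ 2 ^ (2 * N) := Nat.pow_le_pow_right (by norm_num) (by omega)
      _ = 4 ^ N := by rw [pow_mul]; norm_num
    have h3 : padeDenom N * (n + m).choose n ≤ 24 ^ N := calc
      _ ≤ 6 ^ N * 4 ^ N := Nat.mul_le_mul (padeDenom_le N) h2
      _ = 24 ^ N := by rw [← mul_pow]; norm_num
    have h4 : P.eval 1 = ((padeDenom N * (n + m).choose n : ℕ) : ℤ) := by exact_mod_cast h1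
    rw [h4]
    exact_mod_cast h3

/-- Padé approximants to the cube root, with integral coefficients. -/
theorem exists_padeApproximants {n m : ℕ} (h : m = n ∨ m + 1 = n) :
    ∃ P Q F : ℤ[X],
      P.map (Int.castRingHom ℚ) = C (padeDenom n : ℚ) * padePoly (1 / 3) n m ∧
      Q.map (Int.castRingHom ℚ) = C (padeDenom n : ℚ) * padePoly (-1 / 3) m n ∧
      P.comp (X ^ 3) - X * Q.comp (X ^ 3) = (1 - X) ^ (n + m + 1) * F ∧
      IsSmall P n (24 ^ n) ∧ IsSmall Q m (24 ^ n) ∧ IsSmall F n (24 ^ n) := by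
  have hmn : m ≤ n := by omega
  have hnm : n ≤ m + 1 := by omega
  obtain ⟨P, hP, sP⟩ := exists_int_padePoly (δ := 1 / 3) (n := n) (m := m) (N := n)
    (Or.inl rfl) le_rfl hmn (by have : (n : ℚ) ≤ m + 1 := by exact_mod_cast hnm
                                linarith)
  obtain ⟨Q, hQ, sQ⟩ := exists_int_padePoly (δ := -1 / 3) (n := m) (m := n) (N := n)
    (Or.inr rfl) hmn le_rfl (by have : (m : ℚ) ≤ n := by exact_mod_cast hmn
                                linarith)
  -- In both cases the largest exponent is `2n + m + 1`; removing the power `n + m + 1` of `X - 1`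
  -- leaves a cofactor of degree at most `n`.
  have hmax : ∃ b, padeExponents n m ⊆ Finset.Icc 0 b ∧ b ∈ padeExponents n m ∧
      b = n + (n + m + 1) := by
    refine ⟨n + (n + m + 1), fun x hx => ?_, ?_, rfl⟩
    · simp only [padeExponents, Finset.mem_union, Finset.mem_image, Finset.mem_range] at hx
      rw [Finset.mem_Icc]
      omega
    · simp only [padeExponents, Finset.mem_union, Finset.mem_image, Finset.mem_range]
      rcases h with rfl | rfl
      · exact Or.inr ⟨m, by omega, by omega⟩
      · exact Or.inl ⟨m + 1, by omega, by omega⟩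
  obtain ⟨b, hsub, hb, hbe⟩ := hmax
  obtain ⟨G, eG, cG, vG, dG⟩ := exists_dividedDiff_eq (b - 0) (padeExponents n m) 0 b (n + m + 1)
    le_rfl hsub (by simp [padeExponents]) hb (card_padeExponents n m)
  set f : ℤ[X] := P.comp (X ^ 3) - X * Q.comp (X ^ 3) with hf
  have hD : (0 : ℚ) < padeDenom n := by exact_mod_cast padeDenom_pos n
  have hmap : f.map (Int.castRingHom ℚ) =
      (1 - X) ^ (n + m + 1) * (C (padeDenom n * padeConst n m : ℚ) * G) := by
    have h1 := padePoly_comp_sub hnm hmn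
    rw [eG] at h1
    have h2 : (1 - X : ℚ[X]) ^ (n + m + 1) = (-1) ^ (n + m + 1) * (X - 1) ^ (n + m + 1) := by
      rw [← mul_pow]; ring
    rw [hf, Polynomial.map_sub, Polynomial.map_mul, map_comp, map_comp, hP, hQ, h2]
    simp only [Polynomial.map_pow, map_X, mul_comp, C_comp]
    simp only [C_mul, C_pow, C_neg, C_1] at h1 ⊢
    linear_combination C (padeDenom n : ℚ) * h1
  -- The divisor is monic, so divisibility over `ℚ` descends to `ℤ` and the cofactor is integral.
  have hdvd : (X - 1 : ℤ[X]) ^ (n + m + 1) ∣ f := by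
    refine (Polynomial.map_dvd_map (Int.castRingHom ℚ) Int.cast_injective
      ((monic_X_sub_C (1 : ℤ)).pow (n + m + 1))).1 ?_ |> fun h => by simpa using h
    rw [hmap]
    refine Dvd.dvd.mul_right ?_ _
    have h2 : (1 - X : ℚ[X]) ^ (n + m + 1) = (-1) ^ (n + m + 1) * (X - 1) ^ (n + m + 1) := by
      rw [← mul_pow]; ring
    rw [h2]
    simp
  obtain ⟨F', hF'⟩ := hdvd
  have hF : f = (1 - X) ^ (n + m + 1) * ((-1) ^ (n + m + 1) * F') := by
    rw [hF', ← mul_assoc, ← mul_pow]; ring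
  set F : ℤ[X] := (-1) ^ (n + m + 1) * F'
  have hFmap : F.map (Int.castRingHom ℚ) = C (padeDenom n * padeConst n m : ℚ) * G := by
    have h3 : (1 - X : ℚ[X]) ^ (n + m + 1) ≠ 0 := by
      refine pow_ne_zero _ fun h => ?_
      have := congrArg (eval 0) h
      simp at this
    apply mul_left_cancel₀ h3
    rw [← hmap, hF]
    simp
  have hc0 : 0 ≤ padeConst n m := by rw [padeConst_eq]; exact Nat.cast_nonneg _
  refine ⟨P, Q, F, hP, hQ, hF, sP, sQ, fun i => ?_, ?_, ?_⟩
  · have : (0 : ℚ) ≤ F.coeff i := by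
      have : (F.coeff i : ℚ) = (F.map (Int.castRingHom ℚ)).coeff i := by rw [coeff_map]; simp
      rw [this, hFmap, coeff_C_mul]
      exact mul_nonneg (mul_nonneg hD.le hc0) (cG i)
    exact_mod_cast this
  · rw [← natDegree_map_eq_of_injective (f := Int.castRingHom ℚ) Int.cast_injective, hFmap]
    have := natDegree_C_mul_le (padeDenom n * padeConst n m : ℚ) G
    omega
  · have h1 : ((F.eval 1 : ℤ) : ℚ) =
        padeDenom n * padeConst n m * ((n + m + 1).factorial : ℚ)⁻¹ := by
      rw [← vG, ← eval_C (x := (1 : ℚ)) (a := (padeDenom n * padeConst n m : ℚ)), ← eval_mul,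
        ← hFmap, eval_one_map]
      simp
    have h2 : ((F.eval 1 : ℤ) : ℚ) ≤ 6 ^ n * 4 ^ n := by
      rw [h1, mul_assoc]
      refine mul_le_mul (by exact_mod_cast padeDenom_le n) ?_ (by positivity) (by positivity)
      rw [← div_eq_mul_inv, div_le_iff₀ (by positivity)]
      exact padeConst_le h
    rw [← mul_pow] at h2
    norm_num at h2
    exact_mod_cast h2

end PadeApproximants

/-! ### Nonvanishing of one of two consecutive approximants. -/

section Determinant

/-- `X³ - 1 = (X - 1)(X² + X + 1)` has a simple zero at `1`, so substituting `X³` does not change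
the order of vanishing there. -/
theorem pow_dvd_of_pow_dvd_comp {R : ℤ[X]} (hR : R ≠ 0) {N : ℕ}
    (h : (X - 1) ^ N ∣ R.comp (X ^ 3)) : (X - 1) ^ N ∣ R := by
  obtain ⟨S, hS, hnd⟩ := exists_eq_pow_rootMultiplicity_mul_and_not_dvd R hR 1
  set a := R.rootMultiplicity 1
  rw [C_1] at hS hnd
  rcases le_or_gt N a with hle | hlt
  · rw [hS]
    exact (pow_dvd_pow _ hle).mul_right _
  exfalso
  have hcomp : R.comp (X ^ 3) = (X - 1) ^ a * ((X ^ 2 + X + 1) ^ a * S.comp (X ^ 3)) := by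
    rw [hS, mul_comp, pow_comp, sub_comp, X_comp, one_comp, ← mul_assoc, ← mul_pow]
    ring
  obtain ⟨b, rfl⟩ := Nat.exists_eq_add_of_lt hlt
  rw [hcomp, add_assoc, pow_add] at h
  have hX : (X - 1 : ℤ[X]) ≠ 0 := X_sub_C_ne_zero (1 : ℤ)
  have h2 := (mul_dvd_mul_iff_left (pow_ne_zero a hX)).1 h
  have h3 : (X - C 1 : ℤ[X]) ∣ (X ^ 2 + X + 1) ^ a * S.comp (X ^ 3) := by
    rw [C_1]
    exact (dvd_pow_self _ (Nat.succ_ne_zero b)).trans h2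
  rw [dvd_iff_isRoot] at h3
  have h4 : S.eval 1 = 0 := by
    simpa [IsRoot] using h3
  exact hnd (by rw [← C_1, dvd_iff_isRoot]; exact h4)

/-- By Pascal's rule the determinant collapses to `-choose(r + 2/3, r + 1) · choose(r + 1/3, r +
1)`, whose upper arguments are not integers. -/
theorem padeDet_zero_ne_zero (r : ℕ) :
    padeCoeff (1 / 3) (r + 1) (r + 1) 0 * padeCoeff (-1 / 3) r (r + 1) 0 -
      padeCoeff (1 / 3) (r + 1) r 0 * padeCoeff (-1 / 3) (r + 1) (r + 1) 0 ≠ 0 := by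
  simp only [padeCoeff, Ring.choose_zero_right, one_mul, Nat.sub_zero]
  have h := Ring.choose_succ_succ ((r : ℚ) + 1 / 3) r
  have e1 : ((r + 1 : ℕ) : ℚ) - -1 / 3 = r + 1 / 3 + 1 := by push_cast; ring
  have e2 : (r : ℚ) - -1 / 3 = r + 1 / 3 := by ring
  have e3 : ((r + 1 : ℕ) : ℚ) - 1 / 3 = r + 2 / 3 := by push_cast; ring
  rw [e1, e2, e3, h, ← mul_sub, sub_add_cancel_left]
  have key : ∀ c : ℚ, c = 1 / 3 ∨ c = 2 / 3 → ∀ j : ℕ, (r : ℚ) + c ≠ j := by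
    intro c hc j hj
    have h3 : (3 * r : ℚ) + 3 * c = 3 * j := by rw [← hj]; ring
    rcases hc with rfl | rfl <;> norm_num at h3 <;> norm_cast at h3 <;> omega
  exact mul_ne_zero (choose_ne_zero (key _ (Or.inr rfl)))
    (neg_ne_zero.2 (choose_ne_zero (key _ (Or.inl rfl))))

theorem coeff_zero_of_map {P : ℤ[X]} {δ : ℚ} {N n m : ℕ}
    (hP : P.map (Int.castRingHom ℚ) = C (padeDenom N : ℚ) * padePoly δ n m) :
    (P.coeff 0 : ℚ) = padeDenom N * padeCoeff δ n m 0 := by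
  have : (P.coeff 0 : ℚ) = (P.map (Int.castRingHom ℚ)).coeff 0 := by rw [coeff_map]; simp
  rw [this, hP, coeff_C_mul, coeff_padePoly, if_pos (Nat.zero_le _)]

/-- Two consecutive Padé approximants do not degenerate simultaneously. -/
theorem exists_padeApproximants_ne_zero {L : Type*} [Field L] [CharZero L] {r : ℕ} (hr : 1 ≤ r)
    {a b : L} (ha : a ≠ 0) (ha3 : a ^ 3 ≠ 1) :
    ∃ g ≤ 1, ∃ P Q F : ℤ[X],
      P.comp (X ^ 3) - X * Q.comp (X ^ 3) = (1 - X) ^ (2 * r + 1 - g) * F ∧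
      IsSmall P r (24 ^ r) ∧ IsSmall Q (r - g) (24 ^ r) ∧ IsSmall F r (24 ^ r) ∧
      b * aeval (a ^ 3) P - a * aeval (a ^ 3) Q ≠ 0 := by
  obtain ⟨r, rfl⟩ := Nat.exists_eq_add_of_le' hr
  obtain ⟨P₀, Q₀, F₀, hP₀, hQ₀, e₀, sP₀, sQ₀, sF₀⟩ :=
    exists_padeApproximants (n := r + 1) (m := r + 1) (Or.inl rfl)
  obtain ⟨P₁, Q₁, F₁, hP₁, hQ₁, e₁, sP₁, sQ₁, sF₁⟩ :=
    exists_padeApproximants (n := r + 1) (m := r) (Or.inr rfl)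
  by_cases h0 : b * aeval (a ^ 3) P₀ - a * aeval (a ^ 3) Q₀ = 0
  swap
  · exact ⟨0, zero_le_one, P₀, Q₀, F₀, by
      rw [e₀]; congr 2; omega, sP₀, sQ₀, sF₀, h0⟩
  refine ⟨1, le_rfl, P₁, Q₁, F₁, by rw [e₁]; congr 2; omega, sP₁, sQ₁, sF₁, fun h1 => ?_⟩
  -- Both remainders vanish to order at least `2r + 2` at `1`, hence so does this determinant. Its
  -- degree is at most `2r + 2`, so it is a constant times `(X - 1) ^ (2r + 2)`, and the constant is
  -- nonzero because of the value at `0`. Here `r` is one less than in the statement.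
  set R : ℤ[X] := P₀ * Q₁ - P₁ * Q₀ with hRdef
  have hR0 : R.coeff 0 ≠ 0 := by
    have h : (R.coeff 0 : ℚ) = (padeDenom (r + 1) : ℚ) ^ 2 *
        (padeCoeff (1 / 3) (r + 1) (r + 1) 0 * padeCoeff (-1 / 3) r (r + 1) 0 -
        padeCoeff (1 / 3) (r + 1) r 0 * padeCoeff (-1 / 3) (r + 1) (r + 1) 0) := by
      rw [hRdef, coeff_sub, mul_coeff_zero, mul_coeff_zero, Int.cast_sub, Int.cast_mul,
        Int.cast_mul, coeff_zero_of_map hP₀, coeff_zero_of_map hQ₁, coeff_zero_of_map hP₁,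
        coeff_zero_of_map hQ₀]
      ring
    have hD : (padeDenom (r + 1) : ℚ) ≠ 0 := by exact_mod_cast (padeDenom_pos _).ne'
    have : (R.coeff 0 : ℚ) ≠ 0 := by
      rw [h]
      exact mul_ne_zero (pow_ne_zero _ hD) (padeDet_zero_ne_zero r)
    exact_mod_cast this
  have hR : R ≠ 0 := fun h => hR0 (by rw [h, coeff_zero])
  have hdvd : (X - 1 : ℤ[X]) ^ (2 * r + 2) ∣ R.comp (X ^ 3) := by
    have h : R.comp (X ^ 3) = (X - 1) ^ (2 * r + 2) *
        ((1 - X) * F₀ * Q₁.comp (X ^ 3) - F₁ * Q₀.comp (X ^ 3)) := by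
      have hs : (X - 1 : ℤ[X]) ^ (2 * r + 2) = (1 - X) ^ (2 * r + 2) := by
        rw [← neg_sub, Even.neg_pow ⟨r + 1, by ring⟩]
      rw [show r + 1 + (r + 1) + 1 = (2 * r + 2) + 1 by ring] at e₀
      rw [show r + 1 + r + 1 = 2 * r + 2 by ring] at e₁
      rw [hRdef, sub_comp, mul_comp, mul_comp, hs]
      linear_combination Q₁.comp (X ^ 3) * e₀ - Q₀.comp (X ^ 3) * e₁
    exact ⟨_, h⟩
  obtain ⟨S, hS⟩ := pow_dvd_of_pow_dvd_comp hR hdvd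
  have hSdeg : S.natDegree = 0 := by
    have hS0 : S ≠ 0 := fun h => hR (by rw [hS, h, mul_zero])
    have hmon : ((X - 1 : ℤ[X]) ^ (2 * r + 2)).Monic := by
      simpa using (monic_X_sub_C (1 : ℤ)).pow (2 * r + 2)
    have h1 : R.natDegree = (2 * r + 2) + S.natDegree := by
      rw [hS, hmon.natDegree_mul' hS0]
      congr 1
      rw [natDegree_pow, ← C_1, natDegree_X_sub_C, mul_one]
    have h2 : R.natDegree ≤ 2 * r + 2 := by
      refine (natDegree_sub_le _ _).trans (max_le ?_ ?_)
      · have := natDegree_mul_le (p := P₀) (q := Q₁)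
        have h3 := sP₀.natDegree_le
        have h4 := sQ₁.natDegree_le
        omega
      · have := natDegree_mul_le (p := P₁) (q := Q₀)
        have h3 := sP₁.natDegree_le
        have h4 := sQ₀.natDegree_le
        omega
    omega
  obtain ⟨s, rfl⟩ := natDegree_eq_zero.1 hSdeg
  have hs : s ≠ 0 := fun h => hR (by rw [hS, h, C_0, mul_zero])
  have hval : aeval (a ^ 3) R = (a ^ 3 - 1) ^ (2 * r + 2) * (s : L) := by
    rw [hS]; simp
  -- If both linear forms vanished at `(a, b)`, eliminating `b` would make the determinant vanish at
  -- `a³`, which is neither forced by `a = 0` nor by `a³ = 1`.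
  have hzero : a * aeval (a ^ 3) R = 0 := by
    rw [hRdef, map_sub, map_mul, map_mul]
    linear_combination aeval (a ^ 3) P₁ * h0 - aeval (a ^ 3) P₀ * h1
  rw [hval] at hzero
  exact mul_ne_zero ha (mul_ne_zero (pow_ne_zero _ (sub_ne_zero.2 ha3)) (Int.cast_ne_zero.2 hs))
    hzero

end Determinant

/-! ### Normalized absolute values, the product formula and heights. -/

section AbsoluteValues

variable {F : Type*} [Field F] [NumberField F]

/-- The absolute value of which `Place.abv` is a power. -/
noncomputable def Place.base : Place F → AbsoluteValue F ℝ
  | Sum.inl w => w.1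
  | Sum.inr P => HeightOneSpectrum.adicAbv F P

/-- The exponent by which `Place.abv` is normalized. -/
noncomputable def Place.weight : Place F → ℝ
  | Sum.inl w => (w.mult : ℝ) / (Module.finrank ℚ F : ℝ)
  | Sum.inr _ => (1 : ℝ) / (Module.finrank ℚ F : ℝ)

theorem Place.weight_pos (V : Place F) : 0 < V.weight := by
  have h : (0 : ℝ) < Module.finrank ℚ F := by exact_mod_cast Module.finrank_pos
  rcases V with w | P
  · exact div_pos (by exact_mod_cast w.mult_pos) h
  · exact div_pos one_pos h

theorem Place.abv_eq (V : Place F) (x : F) : V.abv x = V.base x ^ V.weight := by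
  rcases V with w | P <;> rfl

/-- The normalized absolute value as a homomorphism. -/
noncomputable def Place.abvHom (V : Place F) : F →*₀ ℝ where
  toFun := V.abv
  map_zero' := by rw [Place.abv_eq, map_zero, Real.zero_rpow V.weight_pos.ne']
  map_one' := by rw [Place.abv_eq, map_one, Real.one_rpow]
  map_mul' x y := by
    rw [Place.abv_eq, Place.abv_eq, Place.abv_eq, map_mul,
      Real.mul_rpow (V.base.nonneg x) (V.base.nonneg y)]

theorem Place.abvHom_apply (V : Place F) (x : F) : V.abvHom x = V.abv x := rfl

theorem Place.abvHom_nonneg (V : Place F) (x : F) : 0 ≤ V.abvHom x := by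
  rw [abvHom_apply, abv_eq]
  exact Real.rpow_nonneg (V.base.nonneg x) _

theorem Place.abvHom_pos (V : Place F) {x : F} (hx : x ≠ 0) : 0 < V.abvHom x :=
  lt_of_le_of_ne (V.abvHom_nonneg x) ((map_ne_zero V.abvHom).2 hx).symm

theorem Place.abvHom_eq_one_of_pow_eq_one (V : Place F) {x : F} {n : ℕ} (hn : n ≠ 0)
    (hx : x ^ n = 1) : V.abvHom x = 1 := by
  have h : V.abvHom x ^ n = 1 := by rw [← map_pow, hx, map_one]
  exact (pow_eq_one_iff_of_nonneg (V.abvHom_nonneg x) hn).1 h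

theorem Place.abvHom_neg (V : Place F) (x : F) : V.abvHom (-x) = V.abvHom x := by
  rw [← neg_one_mul, map_mul, V.abvHom_eq_one_of_pow_eq_one two_ne_zero (by norm_num), one_mul]

/-- The local factor at `V` of an archimedean constant `c`. -/
noncomputable def Place.archConst (c : ℝ) : Place F → ℝ
  | Sum.inl w => c ^ ((w.mult : ℝ) / (Module.finrank ℚ F : ℝ))
  | Sum.inr _ => 1

theorem Place.archConst_nonneg {c : ℝ} (hc : 0 ≤ c) (V : Place F) : 0 ≤ V.archConst c := by
  rcases V with w | P
  · exact Real.rpow_nonneg hc _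
  · exact zero_le_one

theorem Place.archConst_mul {c d : ℝ} (hc : 0 ≤ c) (hd : 0 ≤ d) (V : Place F) :
    V.archConst (c * d) = V.archConst c * V.archConst d := by
  rcases V with w | P
  · exact Real.mul_rpow hc hd
  · exact (mul_one 1).symm

/-- The archimedean exponents sum to `1` because the local degrees add up to the global one.
Archimedean constants in local estimates therefore cost exactly `c` globally. -/
theorem Place.prod_archConst {c : ℝ} (hc : 0 < c) {W : Finset (Place F)}
    (hW : ∀ w : InfinitePlace F, Sum.inl w ∈ W) : ∏ V ∈ W, V.archConst c = c := by
  classical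
  have h1 : ∏ V ∈ W, V.archConst c =
      ∏ V ∈ Finset.univ.map (Function.Embedding.inl (α := InfinitePlace F)
        (β := IsDedekindDomain.HeightOneSpectrum (𝓞 F))), Place.archConst c V := by
    symm
    refine Finset.prod_subset (fun V hV => ?_) fun V _ hV' => ?_
    · obtain ⟨w, -, rfl⟩ := Finset.mem_map.1 hV
      exact hW w
    · rcases V with w | P
      · exact absurd (Finset.mem_map.2 ⟨w, Finset.mem_univ _, rfl⟩) hV'
      · rfl
  have hd : (Module.finrank ℚ F : ℝ) ≠ 0 := by exact_mod_cast Module.finrank_pos.ne'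
  rw [h1, Finset.prod_map]
  simp only [Function.Embedding.inl_apply, Place.archConst]
  rw [← Real.rpow_sum_of_pos hc, ← Finset.sum_div]
  have h2 : (∑ w : InfinitePlace F, (w.mult : ℝ)) = Module.finrank ℚ F := by
    exact_mod_cast InfinitePlace.sum_mult_eq (K := F)
  rw [h2, div_self hd, Real.rpow_one]

theorem Place.abvHom_sub_le (V : Place F) (x y : F) :
    V.abvHom (x - y) ≤ V.archConst 2 * max (V.abvHom x) (V.abvHom y) := by
  have hmax : max (V.abvHom x) (V.abvHom y) = (max (V.base x) (V.base y)) ^ V.weight := by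
    rw [abvHom_apply, abvHom_apply, abv_eq, abv_eq]
    exact ((Real.monotoneOn_rpow_Ici_of_exponent_nonneg V.weight_pos.le).map_max
      (V.base.nonneg x) (V.base.nonneg y)).symm
  have h0 : 0 ≤ max (V.base x) (V.base y) := le_max_of_le_left (V.base.nonneg x)
  rw [hmax, abvHom_apply, abv_eq]
  rcases V with w | P
  · rw [show Place.archConst 2 (Sum.inl w : Place F) =
      2 ^ Place.weight (Sum.inl w : Place F) from rfl, ← Real.mul_rpow zero_le_two h0]
    refine Real.rpow_le_rpow (AbsoluteValue.nonneg _ _) ?_ (Place.weight_pos _).le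
    refine (AbsoluteValue.sub_le_add _ x y).trans ?_
    rw [two_mul]
    exact add_le_add (le_max_left _ _) (le_max_right _ _)
  · rw [show Place.archConst 2 (Sum.inr P : Place F) = 1 from rfl, one_mul]
    refine Real.rpow_le_rpow (AbsoluteValue.nonneg _ _) ?_ (Place.weight_pos _).le
    have h := HeightOneSpectrum.adicAbv_add_le_max F P x (-y)
    rw [AbsoluteValue.map_neg, ← sub_eq_add_neg] at h
    exact h

theorem Place.max_one_rpow_weight (V : Place F) (x : F) :
    (max 1 (V.base x)) ^ V.weight = max 1 (V.abvHom x) := by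
  rw [abvHom_apply, abv_eq, (Real.monotoneOn_rpow_Ici_of_exponent_nonneg V.weight_pos.le).map_max
      (Set.mem_Ici.2 zero_le_one) (V.base.nonneg x), Real.one_rpow]

theorem absoluteValue_natCast_le (f : AbsoluteValue F ℝ) (n : ℕ) : f n ≤ n := by
  induction n with
  | zero => simp
  | succ n ih =>
    push_cast
    refine (f.add_le _ _).trans ?_
    rw [map_one]
    linarith

/-- At an archimedean place the nonnegative coefficients sum to `p(1) ≤ B`; at a finite place they
are integral, so the ultrametric inequality costs no constant. -/
theorem Place.abvHom_aeval_le (V : Place F) {p : ℤ[X]} {d B : ℕ} (hp : IsSmall p d B) (x : F) :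
    V.abvHom (aeval x p) ≤ V.archConst B * max 1 (V.abvHom x) ^ d := by
  have hM : (1 : ℝ) ≤ max 1 (V.base x) := le_max_left _ _
  have hpow : ∀ i ∈ Finset.range (d + 1), V.base x ^ i ≤ max 1 (V.base x) ^ d := fun i hi =>
    (pow_le_pow_left₀ (V.base.nonneg x) (le_max_right _ _) i).trans
      (pow_le_pow_right₀ hM (Nat.lt_succ_iff.1 (Finset.mem_range.1 hi)))
  have heval : aeval x p = ∑ i ∈ Finset.range (d + 1), (p.coeff i : F) * x ^ i := by
    rw [aeval_eq_sum_range' (Nat.lt_succ_of_le hp.natDegree_le)]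
    exact Finset.sum_congr rfl fun i _ => by rw [zsmul_eq_mul]
  have hMd : (0 : ℝ) ≤ max 1 (V.base x) ^ d := by positivity
  have hrp : max 1 (V.abvHom x) ^ d = (max 1 (V.base x) ^ d) ^ V.weight := by
    rw [← V.max_one_rpow_weight, Real.rpow_pow_comm (zero_le_one.trans hM)]
  rw [hrp, abvHom_apply, abv_eq]
  rcases V with w | P
  · rw [show Place.archConst B (Sum.inl w : Place F) =
      (B : ℝ) ^ Place.weight (Sum.inl w : Place F) from rfl, ← Real.mul_rpow (Nat.cast_nonneg _) hMd]
    refine Real.rpow_le_rpow (AbsoluteValue.nonneg _ _) ?_ (Place.weight_pos _).le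
    set f : AbsoluteValue F ℝ := Place.base (Sum.inl w : Place F)
    have hc : ∀ i, f (p.coeff i : F) ≤ (p.coeff i : ℝ) := by
      intro i
      have h := absoluteValue_natCast_le f (p.coeff i).toNat
      have h1 : ((p.coeff i).toNat : ℤ) = p.coeff i := Int.toNat_of_nonneg (hp.coeff_nonneg i)
      have h2 : (((p.coeff i).toNat : ℕ) : F) = (p.coeff i : F) := by
        rw [← Int.cast_natCast, h1]
      have h3 : (((p.coeff i).toNat : ℕ) : ℝ) = (p.coeff i : ℝ) := by
        rw [← Int.cast_natCast, h1]
      rwa [h2, h3] at h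
    have hsum : (∑ i ∈ Finset.range (d + 1), (p.coeff i : ℝ)) ≤ B := by
      have h := hp.eval_one_le
      rw [eval_eq_sum_range' (Nat.lt_succ_of_le hp.natDegree_le)] at h
      simp only [one_pow, mul_one] at h
      exact_mod_cast h
    rw [heval]
    calc f (∑ i ∈ Finset.range (d + 1), (p.coeff i : F) * x ^ i)
        ≤ ∑ i ∈ Finset.range (d + 1), f ((p.coeff i : F) * x ^ i) := f.sum_le _ _
      _ ≤ ∑ i ∈ Finset.range (d + 1), (p.coeff i : ℝ) * max 1 (f x) ^ d := by
          refine Finset.sum_le_sum fun i hi => ?_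
          rw [map_mul, map_pow]
          exact mul_le_mul (hc i) (hpow i hi) (pow_nonneg (f.nonneg x) _)
            (by exact_mod_cast hp.coeff_nonneg i)
      _ ≤ B * max 1 (f x) ^ d := by
          rw [← Finset.sum_mul]
          exact mul_le_mul_of_nonneg_right hsum hMd
  · rw [show Place.archConst B (Sum.inr P : Place F) = 1 from rfl, one_mul]
    refine Real.rpow_le_rpow (AbsoluteValue.nonneg _ _) ?_ (Place.weight_pos _).le
    rw [heval]
    change HeightOneSpectrum.adicAbv F P _ ≤ _
    obtain ⟨i, hi, hle⟩ := (HeightOneSpectrum.isNonarchimedean_adicAbv F P).finset_image_add_of_nonempty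
      (fun i => (p.coeff i : F) * x ^ i) (t := Finset.range (d + 1)) ⟨0, by simp⟩
    refine hle.trans ?_
    rw [map_mul, map_pow]
    refine (mul_le_of_le_one_left (pow_nonneg (AbsoluteValue.nonneg _ _) _)
      (HeightOneSpectrum.adicAbv_intCast_le_one F P _)).trans (hpow i hi)

theorem Place.finite_abv_ne_one {x : F} (hx : x ≠ 0) : {V : Place F | V.abv x ≠ 1}.Finite := by
  have h1 : (Set.range (Sum.inl : InfinitePlace F → Place F)).Finite := Set.finite_range _
  have h2 := (FinitePlace.hasFiniteMulSupport hx).image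
    (fun w : FinitePlace F => (Sum.inr w.maximalIdeal : Place F))
  refine (h1.union h2).subset ?_
  rintro (w | P) hV
  · exact Or.inl ⟨w, rfl⟩
  · refine Or.inr ⟨FinitePlace.mk P, fun h => hV ?_, congrArg Sum.inr (FinitePlace.maximalIdeal_mk P)⟩
    have h' : HeightOneSpectrum.adicAbv F P x = 1 := by
      rw [← FinitePlace.norm_embedding, ← FinitePlace.mk_apply]; exact h
    rw [Place.abv_eq]
    change (HeightOneSpectrum.adicAbv F P x) ^ _ = (1 : ℝ)
    rw [h', Real.one_rpow]

theorem prod_abv_eq_one {x : F} (hx : x ≠ 0) {W : Finset (Place F)}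
    (hW : ∀ V ∉ W, V.abv x = 1) (harch : ∀ w : InfinitePlace F, Sum.inl w ∈ W) :
    ∏ V ∈ W, V.abv x = 1 := by
  classical
  have hd : (Module.finrank ℚ F : ℝ) ≠ 0 := by exact_mod_cast Module.finrank_pos.ne'
  have hsplit : ∏ V ∈ W, V.abv x =
      (∏ w : InfinitePlace F, Place.abv (Sum.inl w : Place F) x) *
        ∏ P ∈ W.toRight, Place.abv (Sum.inr P : Place F) x := by
    have h1 : W = (Finset.univ : Finset (InfinitePlace F)).disjSum W.toRight := by
      ext V
      rcases V with w | P <;> simp [harch]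
    conv_lhs => rw [h1]
    rw [Finset.prod_disjSum]
  have hA : ∏ w : InfinitePlace F, Place.abv (Sum.inl w : Place F) x =
      (∏ w : InfinitePlace F, w x ^ w.mult) ^ ((1 : ℝ) / Module.finrank ℚ F) := by
    rw [← Real.finsetProd_rpow _ _ fun w _ => pow_nonneg (AbsoluteValue.nonneg w.1 x) _]
    refine Finset.prod_congr rfl fun w _ => ?_
    have hw : 0 ≤ w x := AbsoluteValue.nonneg w.1 x
    rw [← Real.rpow_natCast (w x), ← Real.rpow_mul hw, mul_one_div]
    rfl
  have hB : ∏ P ∈ W.toRight, Place.abv (Sum.inr P : Place F) x =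
      (∏ᶠ w : FinitePlace F, w x) ^ ((1 : ℝ) / Module.finrank ℚ F) := by
    have h2 : ∏ᶠ w : FinitePlace F, w x =
        ∏ᶠ P : IsDedekindDomain.HeightOneSpectrum (𝓞 F), HeightOneSpectrum.adicAbv F P x := by
      refine finprod_eq_of_bijective FinitePlace.equivHeightOneSpectrum
        (Equiv.bijective _) fun w => ?_
      rw [← FinitePlace.norm_embedding]
      exact (FinitePlace.norm_embedding_eq w x).symm
    rw [h2, finprod_eq_prod_of_mulSupport_subset (s := W.toRight), ← Real.finsetProd_rpow]
    · rfl
    · exact fun P _ => AbsoluteValue.nonneg _ _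
    · intro P hP
      by_contra hPW
      have h3 : Place.abv (Sum.inr P : Place F) x = 1 :=
        hW _ fun h => hPW (by simpa using h)
      refine hP ?_
      change (HeightOneSpectrum.adicAbv F P x) ^ _ = (1 : ℝ) at h3
      exact (Real.rpow_left_inj (AbsoluteValue.nonneg _ _) zero_le_one (one_div_ne_zero hd)).1
        (h3.trans (Real.one_rpow _).symm)
  have hpos : 0 ≤ ∏ w : InfinitePlace F, w x ^ w.mult :=
    Finset.prod_nonneg fun w _ => pow_nonneg (AbsoluteValue.nonneg w.1 x) _
  rw [hsplit, hA, hB, ← Real.mul_rpow hpos (finprod_nonneg fun w => apply_nonneg w x),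
    prod_abs_eq_one hx, Real.one_rpow]

theorem height_eq_prod {x : F} {W : Finset (Place F)} (hW : ∀ V ∉ W, V.abv x = 1) :
    height x = ∏ V ∈ W, max 1 (V.abv x) := by
  refine finprod_eq_prod_of_mulSupport_subset _ fun V hV => ?_
  by_contra h
  exact hV (by simp [localHeight, hW V h])

theorem one_le_height (x : F) : 1 ≤ height x := by
  exact one_le_finprod fun V => le_max_left _ _

end AbsoluteValues

/-! ### Padé and gap inequalities from the product formula. -/

section ProductFormulaInequalities

variable {F : Type*} [Field F] [NumberField F]

theorem max_one_pow {x : ℝ} (hx : 0 ≤ x) (n : ℕ) : max 1 (x ^ n) = max 1 x ^ n := by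
  rcases le_total 1 x with h | h
  · rw [max_eq_right h, max_eq_right (one_le_pow₀ h)]
  · rw [max_eq_left h, max_eq_left (pow_le_one₀ hx h), one_pow]

theorem Place.abvHom_combination_le (V : Place F) {a b : F} {r g B : ℕ} (hr : 1 ≤ r) (hg : g ≤ 1)
    {P Q : ℤ[X]} (hP : IsSmall P r B) (hQ : IsSmall Q (r - g) B) :
    V.abvHom (b * aeval (a ^ 3) P - a * aeval (a ^ 3) Q) ≤
      V.archConst (2 * B) * (max 1 (V.abvHom a) ^ (3 * r + 1 - g) * max 1 (V.abvHom b)) := by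
  have hc : 0 ≤ V.archConst (B : ℝ) := V.archConst_nonneg (Nat.cast_nonneg _)
  have h1a : 1 ≤ max 1 (V.abvHom a) := le_max_left _ _
  have h1b : 1 ≤ max 1 (V.abvHom b) := le_max_left _ _
  have hpow : ∀ d : ℕ, max 1 (V.abvHom (a ^ 3)) ^ d = max 1 (V.abvHom a) ^ (3 * d) := by
    intro d
    rw [map_pow, max_one_pow (V.abvHom_nonneg a), ← pow_mul]
  have hP' := V.abvHom_aeval_le hP (a ^ 3)
  have hQ' := V.abvHom_aeval_le hQ (a ^ 3)
  rw [hpow] at hP' hQ'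
  rw [Place.archConst_mul zero_le_two (Nat.cast_nonneg B), mul_assoc]
  refine (V.abvHom_sub_le _ _).trans
    (mul_le_mul_of_nonneg_left (max_le ?_ ?_) (V.archConst_nonneg zero_le_two))
  · rw [map_mul]
    calc V.abvHom b * V.abvHom (aeval (a ^ 3) P)
        ≤ max 1 (V.abvHom b) * (V.archConst B * max 1 (V.abvHom a) ^ (3 * r)) :=
          mul_le_mul (le_max_right _ _) hP' (V.abvHom_nonneg _) (zero_le_one.trans h1b)
      _ = V.archConst B * (max 1 (V.abvHom a) ^ (3 * r) * max 1 (V.abvHom b)) := by ring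
      _ ≤ _ := by
          gcongr
          · omega
  · rw [map_mul]
    calc V.abvHom a * V.abvHom (aeval (a ^ 3) Q)
        ≤ max 1 (V.abvHom a) * (V.archConst B * max 1 (V.abvHom a) ^ (3 * (r - g))) :=
          mul_le_mul (le_max_right _ _) hQ' (V.abvHom_nonneg _) (zero_le_one.trans h1a)
      _ = V.archConst B * (max 1 (V.abvHom a) ^ (3 * (r - g) + 1) * 1) := by ring
      _ ≤ _ := by
          gcongr
          · omega

/-- Evaluating the Padé identity at `η a`, where `(η a)³ = a³`, gives `η (b P(a³) - a Q(a³)) = (1 -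
η a)^(2r+1-g) G(η a) - (1 - η b) P(a³)`, and each term carries one of the small factors. -/
theorem Place.abvHom_combination_le_of_system (V : Place F) {a b η : F} {r g B : ℕ} (hr : 1 ≤ r)
    (hg : g ≤ 1) (hη : η ^ 3 = 1) {P Q G : ℤ[X]}
    (he : P.comp (X ^ 3) - X * Q.comp (X ^ 3) = (1 - X) ^ (2 * r + 1 - g) * G)
    (hP : IsSmall P r B) (hQ : IsSmall Q (r - g) B) (hG : IsSmall G r B) :
    V.abvHom (b * aeval (a ^ 3) P - a * aeval (a ^ 3) Q) ≤
      V.archConst (2 * B) * (max 1 (V.abvHom a) ^ (3 * r + 1 - g) * max 1 (V.abvHom b)) *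
        max (min 1 (V.abvHom (1 - η * a)) ^ (2 * r + 1 - g)) (min 1 (V.abvHom (1 - η * b))) := by
  have hη1 : V.abvHom η = 1 := V.abvHom_eq_one_of_pow_eq_one three_ne_zero hη
  have hc : 0 ≤ V.archConst (B : ℝ) := V.archConst_nonneg (Nat.cast_nonneg _)
  have h1a : 1 ≤ max 1 (V.abvHom a) := le_max_left _ _
  have h1b : 1 ≤ max 1 (V.abvHom b) := le_max_left _ _
  have htriv := V.abvHom_combination_le (a := a) (b := b) hr hg hP hQ
  -- If one of the two distances exceeds `1`, the truncated maximum equals `1` and the trivial bound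
  -- suffices.
  rcases le_or_gt (V.abvHom (1 - η * a)) 1 with hA | hA
  swap
  · rwa [min_eq_left hA.le, one_pow, max_eq_left (min_le_left _ _), mul_one]
  rcases le_or_gt (V.abvHom (1 - η * b)) 1 with hB | hB
  swap
  · rwa [min_eq_left hB.le, max_eq_right (pow_le_one₀ (le_min zero_le_one (V.abvHom_nonneg _))
      (min_le_left _ _)), mul_one]
  rw [min_eq_right hA, min_eq_right hB]
  have hP' := V.abvHom_aeval_le hP (a ^ 3)
  have hG' := V.abvHom_aeval_le hG (η * a)
  rw [map_pow, max_one_pow (V.abvHom_nonneg a), ← pow_mul] at hP'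
  rw [map_mul, hη1, one_mul] at hG'
  have hid : η * (b * aeval (a ^ 3) P - a * aeval (a ^ 3) Q) =
      (1 - η * a) ^ (2 * r + 1 - g) * aeval (η * a) G - (1 - η * b) * aeval (a ^ 3) P := by
    have h := congrArg (aeval (η * a)) he
    simp only [map_sub, map_mul, aeval_comp, map_pow, aeval_X, map_one] at h
    rw [mul_pow, hη, one_mul] at h
    rw [← h]
    ring
  have hval : V.abvHom (b * aeval (a ^ 3) P - a * aeval (a ^ 3) Q) =
      V.abvHom (η * (b * aeval (a ^ 3) P - a * aeval (a ^ 3) Q)) := by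
    rw [map_mul, hη1, one_mul]
  rw [hval, hid, Place.archConst_mul zero_le_two (Nat.cast_nonneg B), mul_assoc, mul_assoc]
  refine (V.abvHom_sub_le _ _).trans
    (mul_le_mul_of_nonneg_left (max_le ?_ ?_) (V.archConst_nonneg zero_le_two))
  · rw [map_mul, map_pow]
    calc V.abvHom (1 - η * a) ^ (2 * r + 1 - g) * V.abvHom (aeval (η * a) G)
        ≤ max (V.abvHom (1 - η * a) ^ (2 * r + 1 - g)) (V.abvHom (1 - η * b)) *
            (V.archConst B * max 1 (V.abvHom a) ^ r) :=
          mul_le_mul (le_max_left _ _) hG' (V.abvHom_nonneg _)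
            (le_max_of_le_right (V.abvHom_nonneg _))
      _ = V.archConst B * ((max 1 (V.abvHom a) ^ r * 1) *
            max (V.abvHom (1 - η * a) ^ (2 * r + 1 - g)) (V.abvHom (1 - η * b))) := by ring
      _ ≤ _ := by
          gcongr
          · exact le_max_of_le_right (V.abvHom_nonneg _)
          · omega
  · rw [map_mul]
    calc V.abvHom (1 - η * b) * V.abvHom (aeval (a ^ 3) P)
        ≤ max (V.abvHom (1 - η * a) ^ (2 * r + 1 - g)) (V.abvHom (1 - η * b)) *
            (V.archConst B * max 1 (V.abvHom a) ^ (3 * r)) :=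
          mul_le_mul (le_max_right _ _) hP' (V.abvHom_nonneg _)
            (le_max_of_le_right (V.abvHom_nonneg _))
      _ = V.archConst B * ((max 1 (V.abvHom a) ^ (3 * r) * 1) *
            max (V.abvHom (1 - η * a) ^ (2 * r + 1 - g)) (V.abvHom (1 - η * b))) := by ring
      _ ≤ _ := by
          gcongr
          · exact le_max_of_le_right (V.abvHom_nonneg _)
          · omega

theorem Place.abvHom_sub_le_of_system (V : Place F) {a b η : F} (hη : η ^ 3 = 1) :
    V.abvHom (a - b) ≤ V.archConst 2 * (max 1 (V.abvHom a) * max 1 (V.abvHom b)) *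
      max (min 1 (V.abvHom (1 - η * a))) (min 1 (V.abvHom (1 - η * b))) := by
  have hη1 : V.abvHom η = 1 := V.abvHom_eq_one_of_pow_eq_one three_ne_zero hη
  have h1a : 1 ≤ max 1 (V.abvHom a) := le_max_left _ _
  have h1b : 1 ≤ max 1 (V.abvHom b) := le_max_left _ _
  rw [mul_assoc]
  have hc : (0 : ℝ) ≤ V.archConst 2 := V.archConst_nonneg zero_le_two
  have htriv : V.abvHom (a - b) ≤ V.archConst 2 *
      (max 1 (V.abvHom a) * max 1 (V.abvHom b) * 1) := by
    refine (V.abvHom_sub_le _ _).trans (mul_le_mul_of_nonneg_left (max_le ?_ ?_) hc)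
    · rw [mul_one]
      exact (le_max_right _ _).trans (le_mul_of_one_le_right (zero_le_one.trans h1a) h1b)
    · rw [mul_one]
      exact (le_max_right _ _).trans (le_mul_of_one_le_left (zero_le_one.trans h1b) h1a)
  rcases le_or_gt (V.abvHom (1 - η * a)) 1 with hA | hA
  swap
  · rwa [min_eq_left hA.le, max_eq_left (min_le_left _ _)]
  rcases le_or_gt (V.abvHom (1 - η * b)) 1 with hB | hB
  swap
  · rwa [min_eq_left hB.le, max_eq_right (min_le_left _ _)]
  rw [min_eq_right hA, min_eq_right hB]
  have hval : V.abvHom (a - b) = V.abvHom ((1 - η * b) - (1 - η * a)) := by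
    rw [show (1 - η * b) - (1 - η * a) = η * (a - b) by ring, map_mul, hη1, one_mul]
  rw [hval]
  refine (V.abvHom_sub_le _ _).trans (mul_le_mul_of_nonneg_left ?_ hc)
  rw [max_comm]
  refine le_mul_of_one_le_left (le_max_of_le_left (V.abvHom_nonneg _)) ?_
  exact one_le_mul_of_one_le_of_one_le h1a h1b

/-- The maximum is moved inside the power so that its base is the same at all places of `T`; the
product over `T` then collapses to the exponent `B`. -/
theorem max_le_rpow_max {x y X₁ Y : ℝ} {n : ℕ} {γ : ℝ} (hx : 0 ≤ x) (hX : 0 < X₁)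
    (hγ : 0 ≤ γ) (h1 : x ≤ X₁ ^ γ) (h2 : y ≤ Y ^ γ) (hY : 0 < Y) :
    max (x ^ n) y ≤ (max (X₁ ^ n) Y) ^ γ := by
  refine max_le ?_ (h2.trans (Real.rpow_le_rpow hY.le (le_max_right _ _) hγ))
  calc x ^ n ≤ (X₁ ^ γ) ^ n := pow_le_pow_left₀ hx h1 n
    _ = (X₁ ^ n) ^ γ := Real.rpow_pow_comm hX.le γ n
    _ ≤ _ := Real.rpow_le_rpow (pow_nonneg hX.le n) (le_max_left _ _) hγ

/-- A finite set of places that contains `T` and outside of which the elements of a list are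
units. -/
theorem exists_finset_places (T : Finset (Place F)) (s : Finset F) (hs : ∀ x ∈ s, x ≠ 0) :
    ∃ W : Finset (Place F), T ⊆ W ∧ ∀ x ∈ s, ∀ V ∉ W, V.abv x = 1 := by
  classical
  have hfin : (⋃ x ∈ s, {V : Place F | V.abv x ≠ 1}).Finite :=
    s.finite_toSet.biUnion fun x hx => Place.finite_abv_ne_one (hs x hx)
  refine ⟨T ∪ hfin.toFinset, Finset.subset_union_left, fun x hx V hV => ?_⟩
  by_contra h
  refine hV (Finset.mem_union_right _ (hfin.mem_toFinset.2 ?_))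
  simp only [Set.mem_iUnion]
  exact ⟨x, hx, h⟩

theorem prod_rpow_eq {T : Finset (Place F)} {Gam : Place F → ℝ} {B : ℝ}
    (hsum : ∑ V ∈ T, Gam V = B) {Z : ℝ} (hZ : 0 < Z) : ∏ V ∈ T, Z ^ Gam V = Z ^ B := by
  rw [← Real.rpow_sum_of_pos hZ, hsum]

theorem pade_inequality {T : Finset (Place F)} (harch : ∀ w : InfinitePlace F, Sum.inl w ∈ T)
    {rhoV : Place F → F} {Gam : Place F → ℝ} {B : ℝ} (hrho : ∀ V ∈ T, rhoV V ^ 3 = 1)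
    (hGam : ∀ V ∈ T, 0 ≤ Gam V) (hsum : ∑ V ∈ T, Gam V = B) {r : ℕ} (hr : 1 ≤ r) {a b : F}
    (ha : a ≠ 0) (hb : b ≠ 0) (ha3 : a ^ 3 ≠ 1) {Xa Xb : ℝ} (hXa : 0 < Xa) (hXb : 0 < Xb)
    (hsa : ∀ V ∈ T, min 1 (V.abv (1 - rhoV V * a)) ≤ Xa ^ Gam V)
    (hsb : ∀ V ∈ T, min 1 (V.abv (1 - rhoV V * b)) ≤ Xb ^ Gam V) :
    ∃ g ≤ 1, 1 ≤ 2 * 24 ^ r * height a ^ (3 * r + 1 - g) * height b *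
      (max (Xa ^ (2 * r + 1 - g)) Xb) ^ B := by
  classical
  obtain ⟨g, hg, P, Q, G, he, hP, hQ, hG, hne⟩ :=
    exists_padeApproximants_ne_zero hr (b := b) ha ha3
  refine ⟨g, hg, ?_⟩
  set D := b * aeval (a ^ 3) P - a * aeval (a ^ 3) Q
  obtain ⟨W, hTW, hW⟩ := exists_finset_places T {a, b, D} (by
    simp only [Finset.mem_insert, Finset.mem_singleton]
    rintro x (rfl | rfl | rfl) <;> assumption)
  have hWa := hW a (by simp)
  have hWb := hW b (by simp)
  have hWD := hW D (by simp)
  have hWarch : ∀ w : InfinitePlace F, Sum.inl w ∈ W := fun w => hTW (harch w)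
  set Z := max (Xa ^ (2 * r + 1 - g)) Xb
  have hZ : 0 < Z := lt_max_of_lt_right hXb
  set E : Place F → ℝ := fun V => if V ∈ T then Z ^ Gam V else 1
  have hE : ∏ V ∈ W, E V = Z ^ B := by
    rw [← prod_rpow_eq hsum hZ, Finset.prod_ite, Finset.prod_const_one, mul_one]
    congr 1
    ext V
    simp only [Finset.mem_filter]
    exact ⟨fun h => h.2, fun h => ⟨hTW h, h⟩⟩
  rw [height_eq_prod hWa, height_eq_prod hWb]
  have hc : ((2 : ℝ) * 24 ^ r) = ∏ V ∈ W, Place.archConst (2 * ((24 ^ r : ℕ) : ℝ)) V := by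
    rw [Place.prod_archConst (by positivity) hWarch]
    push_cast; ring
  rw [hc, ← hE, ← Finset.prod_pow, ← Finset.prod_mul_distrib, ← Finset.prod_mul_distrib,
    ← Finset.prod_mul_distrib]
  -- The product formula for the nonzero number `D`, followed by the local estimates: the refined
  -- one on `T`, the trivial one elsewhere.
  refine (prod_abv_eq_one hne hWD hWarch).symm.le.trans ?_
  refine Finset.prod_le_prod (fun V _ => V.abvHom_nonneg D) fun V _ => ?_
  by_cases hVT : V ∈ T
  · have h := V.abvHom_combination_le_of_system (a := a) (b := b) hr hg (hrho V hVT) he hP hQ hG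
    simp only [E, if_pos hVT]
    refine h.trans ?_
    rw [mul_assoc (Place.archConst _ V) (_ ^ _)]
    refine mul_le_mul_of_nonneg_left ?_ (mul_nonneg (V.archConst_nonneg (by positivity))
      (by positivity))
    exact max_le_rpow_max (le_min zero_le_one (V.abvHom_nonneg _)) hXa (hGam V hVT)
      (hsa V hVT) (hsb V hVT) hXb
  · have h := V.abvHom_combination_le (a := a) (b := b) hr hg hP hQ
    simp only [E, if_neg hVT, mul_one]
    rw [mul_assoc]
    exact h

/-- The product formula for `a - b`. The factors `κ` leave room for a saving outside `T`, which is
where the arithmetic of the unit equation enters. -/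
theorem gap_inequality {T : Finset (Place F)} (harch : ∀ w : InfinitePlace F, Sum.inl w ∈ T)
    {rhoV : Place F → F} {Gam : Place F → ℝ} {B : ℝ} (hrho : ∀ V ∈ T, rhoV V ^ 3 = 1)
    (hGam : ∀ V ∈ T, 0 ≤ Gam V) (hsum : ∑ V ∈ T, Gam V = B) {a b : F}
    (ha : a ≠ 0) (hb : b ≠ 0) (hab : a ≠ b) {Xa Xb : ℝ} (hXa : 0 < Xa) (hXb : 0 < Xb)
    (hsa : ∀ V ∈ T, min 1 (V.abv (1 - rhoV V * a)) ≤ Xa ^ Gam V)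
    (hsb : ∀ V ∈ T, min 1 (V.abv (1 - rhoV V * b)) ≤ Xb ^ Gam V)
    {κ : Place F → ℝ} (hκ : {V | κ V ≠ 1}.Finite)
    (hκab : ∀ V ∉ T, V.abv (a - b) ≤ κ V * (max 1 (V.abv a) * max 1 (V.abv b))) :
    1 ≤ 2 * (∏ᶠ (V : Place F) (_ : V ∉ T), κ V) * height a * height b * (max Xa Xb) ^ B := by
  classical
  have hne : a - b ≠ 0 := sub_ne_zero.2 hab
  obtain ⟨W, hTW', hW⟩ := exists_finset_places (T ∪ hκ.toFinset) {a, b, a - b} (by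
    simp only [Finset.mem_insert, Finset.mem_singleton]
    rintro x (rfl | rfl | rfl) <;> assumption)
  have hTW : T ⊆ W := Finset.subset_union_left.trans hTW'
  have hWa := hW a (by simp)
  have hWb := hW b (by simp)
  have hWD := hW (a - b) (by simp)
  have hWarch : ∀ w : InfinitePlace F, Sum.inl w ∈ W := fun w => hTW (harch w)
  have hZ : 0 < max Xa Xb := lt_max_of_lt_right hXb
  have hfin : ∏ᶠ (V : Place F) (_ : V ∉ T), κ V = ∏ V ∈ W, if V ∈ T then 1 else κ V := by
    have h1 : ∀ V, (∏ᶠ (_ : V ∉ T), κ V) = if V ∈ T then 1 else κ V := by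
      intro V
      rw [finprod_eq_if, ite_not]
    rw [finprod_congr h1]
    refine finprod_eq_prod_of_mulSupport_subset _ fun V hV => ?_
    by_contra hVW
    refine hV ?_
    have hVκ : κ V = 1 := by
      by_contra h
      exact hVW (hTW' (Finset.mem_union_right _ (hκ.mem_toFinset.2 h)))
    simp [hVκ]
  have hE : ∏ V ∈ W, (if V ∈ T then (max Xa Xb) ^ Gam V else 1) = (max Xa Xb) ^ B := by
    rw [← prod_rpow_eq hsum hZ, Finset.prod_ite, Finset.prod_const_one, mul_one]
    congr 1
    ext V
    simp only [Finset.mem_filter]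
    exact ⟨fun h => h.2, fun h => ⟨hTW h, h⟩⟩
  rw [height_eq_prod hWa, height_eq_prod hWb, hfin]
  have hc : (2 : ℝ) = ∏ V ∈ W, Place.archConst 2 V :=
    (Place.prod_archConst two_pos hWarch).symm
  rw [hc, ← hE, ← Finset.prod_mul_distrib, ← Finset.prod_mul_distrib, ← Finset.prod_mul_distrib,
    ← Finset.prod_mul_distrib]
  refine (prod_abv_eq_one hne hWD hWarch).symm.le.trans ?_
  refine Finset.prod_le_prod (fun V _ => V.abvHom_nonneg _) fun V _ => ?_
  by_cases hVT : V ∈ T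
  · have h := V.abvHom_sub_le_of_system (a := a) (b := b) (hrho V hVT)
    simp only [if_pos hVT, mul_one]
    refine h.trans ?_
    rw [mul_assoc (Place.archConst _ V) (max 1 (V.abv a))]
    refine mul_le_mul_of_nonneg_left ?_ (mul_nonneg (V.archConst_nonneg zero_le_two)
      (by positivity))
    have := max_le_rpow_max (n := 1) (le_min zero_le_one (V.abvHom_nonneg _)) hXa (hGam V hVT)
      (hsa V hVT) (hsb V hVT) hXb
    rw [pow_one, pow_one] at this
    exact this
  · simp only [if_neg hVT, mul_one]
    refine (hκab V hVT).trans ?_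
    rcases V with w | Q
    · exact absurd (harch w) hVT
    · rw [show Place.archConst 2 (Sum.inr Q : Place F) = 1 from rfl, one_mul, mul_assoc]

end ProductFormulaInequalities

/-! ### Algebra of the quotient `ζ = (a - ρ b) / (a - ρ² b)`. -/

section CubicQuotient

variable {F : Type*} [Field F]

theorem cube_root_relations {ρ : F} (hρ : IsPrimitiveRoot ρ 3) :
    ρ ^ 3 = 1 ∧ ρ ^ 2 + ρ + 1 = 0 := by
  refine ⟨hρ.pow_eq_one, ?_⟩
  have h1 : ρ ≠ 1 := hρ.ne_one (by norm_num)
  have h2 : (ρ - 1) * (ρ ^ 2 + ρ + 1) = 0 := by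
    linear_combination hρ.pow_eq_one
  exact (mul_eq_zero.1 h2).resolve_left (sub_ne_zero.2 h1)

theorem sub_sq_eq_neg_three {ρ : F} (hρ : IsPrimitiveRoot ρ 3) : (ρ - ρ ^ 2) ^ 2 = -3 := by
  linear_combination (ρ ^ 2 - 3 * ρ + 3) * (cube_root_relations hρ).2

/-- The quotient `(a - ρ b) / (a - ρ ^ 2 b)`. -/
def cubicQuotient (ρ a b : F) : F := (a - ρ * b) / (a - ρ ^ 2 * b)

/-- The cubes of numerator and denominator differ by `-3 (ρ - ρ²) a b (a + b)`. -/
theorem cubicQuotient_pow_three_ne_one [CharZero F] {ρ a b : F} (hρ : IsPrimitiveRoot ρ 3)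
    (ha : a ≠ 0) (hb : b ≠ 0) (hab : a + b = 1) (hη : a - ρ ^ 2 * b ≠ 0) :
    cubicQuotient ρ a b ^ 3 ≠ 1 := by
  obtain ⟨h3, h2⟩ := cube_root_relations hρ
  intro h
  rw [cubicQuotient, div_pow, div_eq_one_iff_eq (pow_ne_zero 3 hη)] at h
  have h4 : (ρ - ρ ^ 2) * (3 * (a * b)) * (a + b) = 0 := by
    have h6 : ρ ^ 6 = 1 := by rw [show 6 = 3 * 2 by norm_num, pow_mul, h3, one_pow]
    have h5 : ρ ^ 4 = ρ := by rw [pow_succ, h3, one_mul]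
    linear_combination -h - 3 * a * b ^ 2 * h5 - b ^ 3 * h3 + b ^ 3 * h6
  have hs : ρ - ρ ^ 2 ≠ 0 := by
    intro h0
    have := sub_sq_eq_neg_three hρ
    rw [h0] at this
    norm_num at this
  rw [hab, mul_one] at h4
  exact mul_ne_zero hs (mul_ne_zero three_ne_zero (mul_ne_zero ha hb)) h4

theorem cubicQuotient_sub {ρ a b a' b' : F} (hab : a + b = 1)
    (hab' : a' + b' = 1) (hη : a - ρ ^ 2 * b ≠ 0) (hη' : a' - ρ ^ 2 * b' ≠ 0) :
    cubicQuotient ρ a b - cubicQuotient ρ a' b' =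
      (ρ - ρ ^ 2) * (a - a') / ((a - ρ ^ 2 * b) * (a' - ρ ^ 2 * b')) := by
  obtain rfl : b = 1 - a := by rw [← hab]; ring
  obtain rfl : b' = 1 - a' := by rw [← hab']; ring
  rw [cubicQuotient, cubicQuotient, div_sub_div _ _ hη hη']
  congr 1
  ring

end CubicQuotient

/-! ### Local estimates outside `T` and the constant `A`. -/

section LocalGap

variable {F : Type*} [Field F] [NumberField F]

/-- The local factor that separates two cubic quotients at a place outside `T`. -/
noncomputable def gapFactor (u v : F) (V : Place F) : ℝ :=
  V.abv (u * v) / (V.abv 3 ^ ((1 : ℝ) / 2) * max (V.abv u) (V.abv v) ^ 3)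

theorem Place.abvHom_sub_le_max {V : Place F} (hV : V.archConst 2 = 1) (x y : F) :
    V.abvHom (x - y) ≤ max (V.abvHom x) (V.abvHom y) := by
  have := V.abvHom_sub_le x y
  rwa [hV, one_mul] at this

/-- With `ξ = a - ρ b` and `η = a - ρ² b` one has `(ρ - ρ²) a = ρ η - ρ² ξ` and `(ρ - ρ²) b = η -
ξ`. -/
theorem max_abv_le_of_cubicQuotient {V : Place F} (hV : V.archConst 2 = 1) {ρ a b : F}
    (hρ : IsPrimitiveRoot ρ 3) (hη : a - ρ ^ 2 * b ≠ 0) :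
    V.abvHom (ρ - ρ ^ 2) * max (V.abvHom a) (V.abvHom b) ≤
      V.abvHom (a - ρ ^ 2 * b) * max 1 (V.abvHom (cubicQuotient ρ a b)) := by
  obtain ⟨h3, h2⟩ := cube_root_relations hρ
  have hρ1 : V.abvHom ρ = 1 := V.abvHom_eq_one_of_pow_eq_one three_ne_zero h3
  have hη0 : 0 < V.abvHom (a - ρ ^ 2 * b) := V.abvHom_pos hη
  have hmax : V.abvHom (a - ρ ^ 2 * b) * max 1 (V.abvHom (cubicQuotient ρ a b)) =
      max (V.abvHom (a - ρ ^ 2 * b)) (V.abvHom (a - ρ * b)) := by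
    rw [cubicQuotient, map_div₀, mul_max_of_nonneg _ _ hη0.le, mul_one, mul_div_cancel₀ _ hη0.ne']
  rw [hmax, mul_max_of_nonneg _ _ (V.abvHom_nonneg _)]
  refine max_le ?_ ?_
  · have h : V.abvHom (ρ - ρ ^ 2) * V.abvHom a =
        V.abvHom (ρ * (a - ρ ^ 2 * b) - ρ ^ 2 * (a - ρ * b)) := by
      rw [← map_mul]
      congr 1
      ring
    rw [h]
    refine (Place.abvHom_sub_le_max hV _ _).trans_eq ?_
    rw [map_mul, map_mul, map_pow, hρ1, one_pow, one_mul, one_mul]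
  · have h : V.abvHom (ρ - ρ ^ 2) * V.abvHom b =
        V.abvHom ((a - ρ ^ 2 * b) - (a - ρ * b)) := by
      rw [← map_mul]
      congr 1
      ring
    rw [h]
    exact Place.abvHom_sub_le_max hV _ _

/-- In the formula for the difference, `max_abv_le_of_cubicQuotient` bounds both denominators below,
`|ρ - ρ²| = |3|^(1/2)`, and the numerator is bounded by `min(|u|, |v|)`; finally `min · max = |u
v|`. -/
theorem abv_cubicQuotient_sub_le {V : Place F} (hV : V.archConst 2 = 1) {ρ a b a' b' u v : F}
    (hρ : IsPrimitiveRoot ρ 3) (hu : u ≠ 0) (hv : v ≠ 0) (hab : a + b = 1) (hab' : a' + b' = 1)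
    (hη : a - ρ ^ 2 * b ≠ 0) (hη' : a' - ρ ^ 2 * b' ≠ 0) (ha : V.abv a = V.abv u)
    (hb : V.abv b = V.abv v) (ha' : V.abv a' = V.abv u) (hb' : V.abv b' = V.abv v) :
    V.abv (cubicQuotient ρ a b - cubicQuotient ρ a' b') ≤ gapFactor u v V *
      (max 1 (V.abv (cubicQuotient ρ a b)) * max 1 (V.abv (cubicQuotient ρ a' b'))) := by
  have h1 := max_abv_le_of_cubicQuotient hV hρ hη
  have h2 := max_abv_le_of_cubicQuotient hV hρ hη'
  rw [cubicQuotient_sub hab hab' hη hη']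
  simp only [gapFactor, ← Place.abvHom_apply] at *
  rw [ha, hb] at h1
  rw [ha', hb'] at h2
  have hη0 := V.abvHom_pos hη
  have hη0' := V.abvHom_pos hη'
  have hu0 := V.abvHom_pos hu
  have hv0 := V.abvHom_pos hv
  have hs : V.abvHom (ρ - ρ ^ 2) = V.abvHom 3 ^ ((1 : ℝ) / 2) := by
    have h : V.abvHom (ρ - ρ ^ 2) ^ 2 = V.abvHom 3 := by
      rw [← map_pow, sub_sq_eq_neg_three hρ, V.abvHom_neg]
    rw [← h, ← Real.sqrt_eq_rpow, Real.sqrt_sq (V.abvHom_nonneg _)]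
  have hs0 : 0 < V.abvHom 3 ^ ((1 : ℝ) / 2) := Real.rpow_pos_of_pos (V.abvHom_pos three_ne_zero) _
  -- Since both pairs sum to `1`, `a - a' = b' - b`, so either coordinate bounds the difference.
  have hmn : V.abvHom (a - a') ≤ min (V.abvHom u) (V.abvHom v) := by
    refine le_min ?_ ?_
    · have := Place.abvHom_sub_le_max hV a a'
      rwa [ha, ha', max_self] at this
    · have := Place.abvHom_sub_le_max hV b' b
      rw [hb, hb', max_self] at this
      rwa [show a - a' = b' - b by linear_combination hab - hab']
  rw [map_div₀, map_mul, map_mul, map_mul, hs, ← min_mul_max (V.abvHom u)]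
  rw [hs] at h1 h2
  set s := V.abvHom 3 ^ ((1 : ℝ) / 2)
  set M := max (V.abvHom u) (V.abvHom v)
  have hM : 0 < M := lt_max_of_lt_left hu0
  set N := min (V.abvHom u) (V.abvHom v)
  have hN : 0 < N := lt_min hu0 hv0
  set h := max 1 (V.abvHom (cubicQuotient ρ a b))
  set h' := max 1 (V.abvHom (cubicQuotient ρ a' b'))
  rw [div_mul_eq_mul_div, div_le_div_iff₀ (by positivity) (by positivity)]
  calc s * V.abvHom (a - a') * (s * M ^ 3) ≤ s * N * (s * M ^ 3) := by gcongr
    _ = (N * M) * ((s * M) * (s * M)) := by ring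
    _ ≤ (N * M) * ((V.abvHom (a - ρ ^ 2 * b) * h) * (V.abvHom (a' - ρ ^ 2 * b') * h')) := by
        gcongr
    _ = _ := by ring

theorem finprod_notMem_eq_prod [DecidableEq (Place F)] {T W : Finset (Place F)} {f : Place F → ℝ}
    (hf : ∀ V ∉ W, f V = 1) : ∏ᶠ (V : Place F) (_ : V ∉ T), f V = ∏ V ∈ W \ T, f V := by
  have h1 : ∀ V, (∏ᶠ (_ : V ∉ T), f V) = if V ∉ T then f V else 1 := fun V => finprod_eq_if
  rw [finprod_congr h1, Finset.sdiff_eq_filter, Finset.prod_filter]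
  refine finprod_eq_prod_of_mulSupport_subset _ fun V hV => ?_
  by_contra hVW
  exact hV (by simp [hf V hVW])

theorem prod_sdiff_abv [DecidableEq (Place F)] {T W : Finset (Place F)} (hTW : T ⊆ W)
    (harch : ∀ w : InfinitePlace F, Sum.inl w ∈ T) {x : F} (hx : x ≠ 0)
    (hW : ∀ V ∉ W, V.abv x = 1) :
    (∏ V ∈ W \ T, V.abv x) * ∏ V ∈ T, V.abv x = 1 := by
  rw [Finset.prod_sdiff hTW, prod_abv_eq_one hx hW fun w => hTW (harch w)]

theorem Place.abvHom_three_le (V : Place F) : V.abvHom 3 ≤ V.archConst 3 := by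
  have h := V.abvHom_aeval_le (p := C 3) (d := 0) (B := 3)
    ⟨fun i => by rw [coeff_C]; split_ifs <;> norm_num, by simp, by simp⟩ 0
  simpa only [map_ofNat, pow_zero, mul_one, Nat.cast_ofNat] using h

/-- The constant `A` of a number field containing the cube roots of unity. -/
noncomputable def baseConst (T : Finset (Place F)) (u v : F) : ℝ :=
  (∏ V ∈ T, V.abv (3 : F)) ^ ((1 : ℝ) / 2) * (∏ V ∈ T, V.abv (u * v)) *
    (∏ᶠ (V : Place F) (_ : V ∉ T), max (V.abv u) (V.abv v)) ^ 3

theorem finite_gapFactor_ne_one {u v : F} (hu : u ≠ 0) (hv : v ≠ 0) :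
    {V : Place F | gapFactor u v V ≠ 1}.Finite := by
  classical
  obtain ⟨W, -, hW⟩ := exists_finset_places (F := F) ∅ {u, v, 3} (by
    simp only [Finset.mem_insert, Finset.mem_singleton]
    rintro x (rfl | rfl | rfl)
    exacts [hu, hv, three_ne_zero])
  refine W.finite_toSet.subset fun V hV => ?_
  by_contra h
  refine hV ?_
  have h1 := hW u (by simp) V h
  have h2 := hW v (by simp) V h
  have h3 := hW 3 (by simp) V h
  have h4 : V.abv (u * v) = 1 := by
    rw [← Place.abvHom_apply, map_mul, Place.abvHom_apply, Place.abvHom_apply, h1, h2, one_mul]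
  simp [gapFactor, h1, h2, h3, h4]

theorem one_le_prod_abv_three {T : Finset (Place F)}
    (harch : ∀ w : InfinitePlace F, Sum.inl w ∈ T) :
    1 ≤ ∏ V ∈ T, V.abv (3 : F) ∧ ∏ V ∈ T, V.abv (3 : F) ≤ 3 := by
  classical
  obtain ⟨W, hTW, hW⟩ := exists_finset_places T {(3 : F)} (by simp)
  have h := prod_sdiff_abv hTW harch three_ne_zero (hW 3 (by simp))
  have h0 : 0 ≤ ∏ V ∈ T, V.abv (3 : F) := Finset.prod_nonneg fun V _ => V.abvHom_nonneg 3
  constructor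
  · have h1 : ∏ V ∈ W \ T, V.abv (3 : F) ≤ 1 := by
      refine Finset.prod_le_one (fun V _ => V.abvHom_nonneg 3) fun V hV => ?_
      refine V.abvHom_three_le.trans ?_
      rcases V with w | P
      · exact absurd (harch w) (Finset.mem_sdiff.1 hV).2
      · exact le_rfl
    nlinarith
  · calc ∏ V ∈ T, V.abv (3 : F) ≤ ∏ V ∈ T, V.archConst 3 :=
        Finset.prod_le_prod (fun V _ => V.abvHom_nonneg 3) fun V _ => V.abvHom_three_le
      _ = 3 := Place.prod_archConst three_pos harch

/-- The product formula for `u v` and for `3` moves the factors outside `T` onto `T`, and the cubes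
of the maxima cancel. Thus the gap factors multiply to at most `3 / A`. -/
theorem baseConst_mul_finprod_gapFactor {T : Finset (Place F)}
    (harch : ∀ w : InfinitePlace F, Sum.inl w ∈ T) {u v : F} (hu : u ≠ 0) (hv : v ≠ 0) :
    0 < baseConst T u v ∧
    baseConst T u v * (∏ᶠ (V : Place F) (_ : V ∉ T), gapFactor u v V) = ∏ V ∈ T, V.abv (3 : F) := by
  classical
  obtain ⟨W, hTW, hW⟩ := exists_finset_places T {u, v, 3} (by
    simp only [Finset.mem_insert, Finset.mem_singleton]
    rintro x (rfl | rfl | rfl)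
    exacts [hu, hv, three_ne_zero])
  have huv := mul_ne_zero hu hv
  have hWu := hW u (by simp)
  have hWv := hW v (by simp)
  have hW3 := hW 3 (by simp)
  have hWuv : ∀ V ∉ W, V.abv (u * v) = 1 := fun V h => by
    rw [← Place.abvHom_apply, map_mul, Place.abvHom_apply, Place.abvHom_apply, hWu V h, hWv V h,
      one_mul]
  have h3 := prod_sdiff_abv hTW harch three_ne_zero hW3
  have h4 := prod_sdiff_abv hTW harch huv hWuv
  have hg : ∏ᶠ (V : Place F) (_ : V ∉ T), gapFactor u v V = ∏ V ∈ W \ T, gapFactor u v V :=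
    finprod_notMem_eq_prod fun V hV => by
      simp [gapFactor, hWu V hV, hWv V hV, hW3 V hV, hWuv V hV]
  have hm : ∏ᶠ (V : Place F) (_ : V ∉ T), max (V.abv u) (V.abv v) =
      ∏ V ∈ W \ T, max (V.abv u) (V.abv v) :=
    finprod_notMem_eq_prod fun V hV => by simp [hWu V hV, hWv V hV]
  rw [hg, baseConst, hm]
  simp only [gapFactor]
  rw [Finset.prod_div_distrib, Finset.prod_mul_distrib, Finset.prod_pow,
    Real.finsetProd_rpow _ _ fun V _ => V.abvHom_nonneg 3]
  have p1 : 0 < ∏ V ∈ T, V.abv (3 : F) := Finset.prod_pos fun V _ => V.abvHom_pos three_ne_zero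
  have p2 : 0 < ∏ V ∈ W \ T, V.abv (3 : F) :=
    Finset.prod_pos fun V _ => V.abvHom_pos three_ne_zero
  have p3 : 0 < ∏ V ∈ T, V.abv (u * v) := Finset.prod_pos fun V _ => V.abvHom_pos huv
  have p4 : 0 < ∏ V ∈ W \ T, max (V.abv u) (V.abv v) :=
    Finset.prod_pos fun V _ => lt_max_of_lt_left (V.abvHom_pos hu)
  set a := ∏ V ∈ T, V.abv (3 : F)
  set b := ∏ V ∈ W \ T, V.abv (3 : F)
  have hb : b = a⁻¹ := eq_inv_of_mul_eq_one_left h3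
  have e1 : b ^ ((1 : ℝ) / 2) * a ^ ((1 : ℝ) / 2) = 1 := by
    rw [← Real.mul_rpow p2.le p1.le, h3, Real.one_rpow]
  have e2 : a ^ ((1 : ℝ) / 2) * a ^ ((1 : ℝ) / 2) = a := by
    rw [← Real.rpow_add p1]; norm_num
  have q1 : 0 < a ^ ((1 : ℝ) / 2) := Real.rpow_pos_of_pos p1 _
  have q2 : 0 < b ^ ((1 : ℝ) / 2) := Real.rpow_pos_of_pos p2 _
  refine ⟨by positivity, ?_⟩
  rw [mul_div_assoc', div_eq_iff (by positivity)]
  linear_combination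
    (a ^ ((1 : ℝ) / 2) * (∏ V ∈ W \ T, max (V.abv u) (V.abv v)) ^ 3) * h4 -
      (a ^ ((1 : ℝ) / 2) * (∏ V ∈ W \ T, max (V.abv u) (V.abv v)) ^ 3) * e1 +
      (b ^ ((1 : ℝ) / 2) * (∏ V ∈ W \ T, max (V.abv u) (V.abv v)) ^ 3) * e2

/-- Outside `T`, `|u v| ≤ max² ≤ max³`; the product formula transfers this to the product of `|u v|`
over `T`. -/
theorem one_le_baseConst {T : Finset (Place F)}
    (harch : ∀ w : InfinitePlace F, Sum.inl w ∈ T) {u v : F} (hu : u ≠ 0) (hv : v ≠ 0)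
    (hmax : ∀ V ∉ T, 1 ≤ max (V.abv u) (V.abv v)) : 1 ≤ baseConst T u v := by
  classical
  obtain ⟨W, hTW, hW⟩ := exists_finset_places T {u, v} (by
    simp only [Finset.mem_insert, Finset.mem_singleton]
    rintro x (rfl | rfl)
    exacts [hu, hv])
  have hWu := hW u (by simp)
  have hWv := hW v (by simp)
  have hWuv : ∀ V ∉ W, V.abv (u * v) = 1 := fun V h => by
    rw [← Place.abvHom_apply, map_mul, Place.abvHom_apply, Place.abvHom_apply, hWu V h, hWv V h,
      one_mul]
  have h4 := prod_sdiff_abv hTW harch (mul_ne_zero hu hv) hWuv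
  have hm : ∏ᶠ (V : Place F) (_ : V ∉ T), max (V.abv u) (V.abv v) =
      ∏ V ∈ W \ T, max (V.abv u) (V.abv v) :=
    finprod_notMem_eq_prod fun V hV => by simp [hWu V hV, hWv V hV]
  have p3 : 0 < ∏ V ∈ T, V.abv (u * v) :=
    Finset.prod_pos fun V _ => V.abvHom_pos (mul_ne_zero hu hv)
  have h5 : ∏ V ∈ W \ T, V.abv (u * v) ≤ (∏ V ∈ W \ T, max (V.abv u) (V.abv v)) ^ 3 := by
    rw [← Finset.prod_pow]
    refine Finset.prod_le_prod (fun V _ => V.abvHom_nonneg _) fun V hV => ?_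
    have h1 := hmax V (Finset.mem_sdiff.1 hV).2
    calc V.abv (u * v) = V.abv u * V.abv v := map_mul V.abvHom u v
      _ ≤ max (V.abv u) (V.abv v) * max (V.abv u) (V.abv v) :=
          mul_le_mul (le_max_left _ _) (le_max_right _ _) (V.abvHom_nonneg v) (by positivity)
      _ ≤ max (V.abv u) (V.abv v) * max (V.abv u) (V.abv v) * max (V.abv u) (V.abv v) :=
          le_mul_of_one_le_right (by positivity) h1
      _ = _ := by ring
  have h6 : 1 ≤ (∏ V ∈ T, V.abv (3 : F)) ^ ((1 : ℝ) / 2) :=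
    Real.one_le_rpow (one_le_prod_abv_three harch).1 (by norm_num)
  rw [baseConst, hm, mul_assoc]
  refine one_le_mul_of_one_le_of_one_le h6 ?_
  rw [← h4, mul_comm]
  exact mul_le_mul_of_nonneg_left h5 p3.le

end LocalGap

end SUnitPade

namespace SUnitPade

/-! ### Application to the solutions of the `S`-unit equation. -/

section SUnits

variable {K L : Type*} [Field K] [NumberField K] [Field L] [NumberField L] [Algebra K L]

theorem mem_placesAbove {S : Finset (Place K)} {V : Place L} :
    V ∈ placesAbove L S ↔ Place.below K V ∈ S := by
  rw [placesAbove, Set.Finite.mem_toFinset]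
  rfl

theorem inl_mem_placesAbove {S : Finset (Place K)} (hS : ∀ w : InfinitePlace K, Sum.inl w ∈ S)
    (w : InfinitePlace L) : (Sum.inl w : Place L) ∈ placesAbove L S :=
  mem_placesAbove.2 (hS _)

/-- A place outside `T` is finite, and its valuation on `K` is a power of the valuation below, so
value `1` is inherited. -/
theorem IsSUnit.abv_algebraMap {S : Finset (Place K)}
    (hS : ∀ w : InfinitePlace K, Sum.inl w ∈ S) {x : K} (hx : IsSUnit S x) {V : Place L}
    (hV : V ∉ placesAbove L S) : V.abv (algebraMap K L x) = 1 := by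
  rcases V with w | P
  · exact absurd (inl_mem_placesAbove hS w) hV
  have h1 := hx.2 _ (fun h => hV (mem_placesAbove.2 h))
  have hd : (Module.finrank ℚ K : ℝ) ≠ 0 := by exact_mod_cast Module.finrank_pos.ne'
  have h2 : HeightOneSpectrum.adicAbv K (P.under (𝓞 K)) x = 1 :=
    (Real.rpow_left_inj (AbsoluteValue.nonneg _ _) zero_le_one (one_div_ne_zero hd)).1
      (Eq.trans h1 (Real.one_rpow _).symm)
  have h3 : (P.under (𝓞 K)).valuation K x = 1 := by
    rw [HeightOneSpectrum.adicAbv_def] at h2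
    have h4 : WithZeroMulInt.toNNReal (HeightOneSpectrum.absNorm_ne_zero (P.under (𝓞 K)))
        ((P.under (𝓞 K)).valuation K x) = 1 := by exact_mod_cast h2
    exact (WithZeroMulInt.toNNReal_eq_one_iff _ (HeightOneSpectrum.absNorm_ne_zero _)
      (HeightOneSpectrum.one_lt_absNorm_nnreal _).ne').1 h4
  have : P.asIdeal.LiesOver (P.under (𝓞 K)).asIdeal := ⟨rfl⟩
  have h5 := IsDedekindDomain.HeightOneSpectrum.valuation_liesOver L (P.under (𝓞 K)) P x
  rw [h3, one_pow] at h5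
  change (HeightOneSpectrum.adicAbv L P (algebraMap K L x)) ^ _ = (1 : ℝ)
  rw [HeightOneSpectrum.adicAbv_def, ← h5, map_one, NNReal.coe_one, Real.one_rpow]

theorem constA_eq_baseConst (S : Finset (Place K)) (l m : K) :
    constA L S l m = baseConst (placesAbove L S) (algebraMap K L l) (algebraMap K L m) := by
  rw [constA, baseConst, map_mul]

/-- Excluding roots of unity makes numerator and denominator nonzero: if either vanished, `a / b`
would be a cube root of unity. -/
theorem exists_of_mem_V0 {ρ : L} (hρ : IsPrimitiveRoot ρ 3) {l m : K} (hl : l ≠ 0) (hm : m ≠ 0)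
    {S : Finset (Place K)} (hS : ∀ w : InfinitePlace K, Sum.inl w ∈ S) {z : L}
    (hz : z ∈ V0 S ρ l m) :
    ∃ a b : L, a + b = 1 ∧ a ≠ 0 ∧ b ≠ 0 ∧ a - ρ * b ≠ 0 ∧ a - ρ ^ 2 * b ≠ 0 ∧
      z = cubicQuotient ρ a b ∧ ∀ V ∉ placesAbove L S, V.abv a = V.abv (algebraMap K L l) ∧
        V.abv b = V.abv (algebraMap K L m) := by
  obtain ⟨x, y, hx, hy, hxy, hroot, rfl⟩ := hz
  have ha : algebraMap K L (l * x) ≠ 0 := (map_ne_zero _).2 (mul_ne_zero hl hx.1)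
  have hb : algebraMap K L (m * y) ≠ 0 := (map_ne_zero _).2 (mul_ne_zero hm hy.1)
  have hne : ∀ η : L, η ^ 3 = 1 → algebraMap K L (l * x) - η * algebraMap K L (m * y) ≠ 0 := by
    intro η hη h
    refine hroot ?_
    rw [map_div₀, sub_eq_zero.1 h, mul_div_cancel_right₀ _ hb]
    exact isOfFinOrder_iff_pow_eq_one.2 ⟨3, by norm_num, hη⟩
  refine ⟨_, _, by rw [← map_add, hxy, map_one], ha, hb, hne ρ hρ.pow_eq_one,
    hne (ρ ^ 2) (by rw [← pow_mul, mul_comm, pow_mul, hρ.pow_eq_one, one_pow]), rfl,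
    fun V hV => ⟨?_, ?_⟩⟩
  · rw [← Place.abvHom_apply, map_mul, map_mul, Place.abvHom_apply, Place.abvHom_apply,
      hx.abv_algebraMap hS hV, mul_one]
  · rw [← Place.abvHom_apply, map_mul, map_mul, Place.abvHom_apply, Place.abvHom_apply,
      hy.abv_algebraMap hS hV, mul_one]

theorem archConst_eq_one_of_notMem {S : Finset (Place K)}
    (hS : ∀ w : InfinitePlace K, Sum.inl w ∈ S) {V : Place L} (hV : V ∉ placesAbove L S) (c : ℝ) :
    V.archConst c = 1 := by
  rcases V with w | P
  · exact absurd (inl_mem_placesAbove hS w) hV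
  · rfl

/-- A solution is needed: at a place outside `T` the equation `a + b = 1` forces `1 ≤ max(|l|,
|m|)`. -/
theorem one_le_constA {ρ : L} (hρ : IsPrimitiveRoot ρ 3) {l m : K} (hl : l ≠ 0) (hm : m ≠ 0)
    {S : Finset (Place K)} (hS : ∀ w : InfinitePlace K, Sum.inl w ∈ S) {z : L}
    (hz : z ∈ V0 S ρ l m) : 1 ≤ constA L S l m := by
  obtain ⟨a, b, hab, -, -, -, -, -, hV⟩ := exists_of_mem_V0 hρ hl hm hS hz
  rw [constA_eq_baseConst]
  refine one_le_baseConst (inl_mem_placesAbove hS) ((map_ne_zero _).2 hl) ((map_ne_zero _).2 hm)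
    fun V hVT => ?_
  rw [← (hV V hVT).1, ← (hV V hVT).2]
  have h := Place.abvHom_sub_le_max (archConst_eq_one_of_notMem hS hVT 2) a (-b)
  rwa [sub_neg_eq_add, hab, map_one, V.abvHom_neg] at h

variable {ρ : L} {l m : K} {S : Finset (Place K)} {B : ℝ} {rhoV : Place L → L}
  {Gam : Place L → ℝ}

/-- The constant is `48 = 8 · 2 · 3`: the normalization of `8A`, the triangle inequality, and the
bound `3` for `A` times the gap factors. -/
theorem gap_of_mem_V0 (hρ : IsPrimitiveRoot ρ 3) (hl : l ≠ 0) (hm : m ≠ 0)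
    (hS : ∀ w : InfinitePlace K, Sum.inl w ∈ S)
    (hrhoV : ∀ V ∈ placesAbove L S, rhoV V ^ 3 = 1)
    (hGam : ∀ V ∈ placesAbove L S, 0 ≤ Gam V) (hsum : ∑ V ∈ placesAbove L S, Gam V = B)
    {z z' : L} (hz : z ∈ V0 S ρ l m) (hz' : z' ∈ V0 S ρ l m) (hne : z ≠ z')
    (hsys : SatisfiesSystem S l m rhoV Gam z) (hsys' : SatisfiesSystem S l m rhoV Gam z')
    (hle : height z ≤ height z') :
    8 * constA L S l m ≤
      48 * height z * height z' * (8 * constA L S l m / height z ^ 3) ^ B := by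
  have hA1 := one_le_constA hρ hl hm hS hz
  have hH := one_le_height z
  have hH' := one_le_height z'
  obtain ⟨a, b, hab, ha, hb, hξ, hη, hzq, hV⟩ := exists_of_mem_V0 hρ hl hm hS hz
  obtain ⟨a', b', hab', ha', hb', hξ', hη', hzq', hV'⟩ := exists_of_mem_V0 hρ hl hm hS hz'
  have hz0 : z ≠ 0 := by rw [hzq]; exact div_ne_zero hξ hη
  have hz0' : z' ≠ 0 := by rw [hzq']; exact div_ne_zero hξ' hη'
  have hu : algebraMap K L l ≠ 0 := (map_ne_zero _).2 hl
  have hv : algebraMap K L m ≠ 0 := (map_ne_zero _).2 hm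
  have harch := inl_mem_placesAbove (L := L) hS
  have hX : 0 < 8 * constA L S l m / height z ^ 3 := by positivity
  have hX' : 0 < 8 * constA L S l m / height z' ^ 3 := by positivity
  have h := gap_inequality harch hrhoV hGam hsum hz0 hz0' hne hX hX' hsys hsys'
    (finite_gapFactor_ne_one hu hv) fun V hVT => by
      rw [hzq, hzq']
      exact abv_cubicQuotient_sub_le (archConst_eq_one_of_notMem hS hVT 2) hρ hu hv hab hab' hη
        hη' (hV V hVT).1 (hV V hVT).2 (hV' V hVT).1 (hV' V hVT).2
  obtain ⟨hA0, hAp⟩ := baseConst_mul_finprod_gapFactor harch hu hv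
  rw [← constA_eq_baseConst] at hA0 hAp
  have hle3 := (one_le_prod_abv_three harch).2
  rw [← hAp] at hle3
  rw [max_eq_left (by gcongr)] at h
  set c := constA L S l m
  set p := ∏ᶠ (V : Place L) (_ : V ∉ placesAbove L S),
    gapFactor (algebraMap K L l) (algebraMap K L m) V
  set E := (8 * c / height z ^ 3) ^ B
  have hE : 0 < E := Real.rpow_pos_of_pos hX B
  calc 8 * c = 8 * c * 1 := (mul_one _).symm
    _ ≤ 8 * c * (2 * p * height z * height z' * E) := by gcongr
    _ = 16 * (c * p) * (height z * height z' * E) := by ring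
    _ ≤ 16 * 3 * (height z * height z' * E) := by gcongr
    _ = _ := by ring

/-- Nonvanishing rests on `z³ ≠ 1`, not on `z ≠ z'`; equality of the two is allowed and occurs when
`k = 0`. -/
theorem pade_of_mem_V0 (hρ : IsPrimitiveRoot ρ 3) (hl : l ≠ 0) (hm : m ≠ 0)
    (hS : ∀ w : InfinitePlace K, Sum.inl w ∈ S)
    (hrhoV : ∀ V ∈ placesAbove L S, rhoV V ^ 3 = 1)
    (hGam : ∀ V ∈ placesAbove L S, 0 ≤ Gam V) (hsum : ∑ V ∈ placesAbove L S, Gam V = B)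
    {z z' : L} (hz : z ∈ V0 S ρ l m) (hz' : z' ∈ V0 S ρ l m)
    (hsys : SatisfiesSystem S l m rhoV Gam z) (hsys' : SatisfiesSystem S l m rhoV Gam z')
    {r : ℕ} (hr : 1 ≤ r) :
    ∃ g ≤ 1, 1 ≤ 2 * 24 ^ r * height z ^ (3 * r + 1 - g) * height z' *
      (max ((8 * constA L S l m / height z ^ 3) ^ (2 * r + 1 - g))
        (8 * constA L S l m / height z' ^ 3)) ^ B := by
  have hA1 := one_le_constA hρ hl hm hS hz
  have hH := one_le_height z
  have hH' := one_le_height z'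
  obtain ⟨a, b, hab, ha, hb, hξ, hη, hzq, -⟩ := exists_of_mem_V0 hρ hl hm hS hz
  obtain ⟨a', b', -, -, -, hξ', hη', hzq', -⟩ := exists_of_mem_V0 hρ hl hm hS hz'
  have hz0 : z ≠ 0 := by rw [hzq]; exact div_ne_zero hξ hη
  have hz0' : z' ≠ 0 := by rw [hzq']; exact div_ne_zero hξ' hη'
  have hz3 : z ^ 3 ≠ 1 := by
    rw [hzq]
    exact cubicQuotient_pow_three_ne_one hρ ha hb hab hη
  exact pade_inequality (inl_mem_placesAbove hS) hrhoV hGam hsum hr hz0 hz0' hz3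
    (by positivity) (by positivity) hsys hsys'

end SUnits

/-! ### Chains of heights and the final contradiction. -/

section RealEstimates

/-- Iterates the gap principle: remove an element of maximal height and apply one gap from the top
of the remaining chain. -/
theorem exists_pow_mul_add_le {α : Type*} {s : Set α} {h : α → ℝ} {G E : ℝ} (hG : 0 ≤ G)
    (hgap : ∀ x ∈ s, ∀ y ∈ s, x ≠ y → h x ≤ h y → G * h x + E ≤ h y) (k : ℕ) :
    ∀ t : Finset α, (t : Set α) ⊆ s → t.card = k + 1 →
      ∃ x ∈ t, ∃ y ∈ t, G ^ k * h x + E * ∑ i ∈ Finset.range k, G ^ i ≤ h y := by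
  classical
  induction k with
  | zero =>
    intro t _ hcard
    obtain ⟨x, hx⟩ := Finset.card_pos.1 (by omega : 0 < t.card)
    exact ⟨x, hx, x, hx, by simp⟩
  | succ k ih =>
    intro t hts hcard
    obtain ⟨y, hy, hmax⟩ := t.exists_max_image h (Finset.card_pos.1 (by omega))
    obtain ⟨x, hx, y', hy', hle⟩ := ih (t.erase y)
      (fun a ha => hts (Finset.mem_of_mem_erase ha)) (by
        rw [Finset.card_erase_of_mem hy, hcard]; rfl)
    have hy't := Finset.mem_of_mem_erase hy'
    have h1 := hgap y' (hts hy't) y (hts hy) (Finset.ne_of_mem_erase hy') (hmax y' hy't)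
    refine ⟨x, Finset.mem_of_mem_erase hx, y, hy, le_trans ?_ h1⟩
    have h2 := mul_le_mul_of_nonneg_left hle hG
    rw [geom_sum_succ, pow_succ]
    linarith

theorem finite_and_ncard_le {α : Type*} {s : Set α} {k : ℕ}
    (h : ∀ t : Finset α, (t : Set α) ⊆ s → t.card ≠ k + 1) : s.Finite ∧ s.ncard ≤ k := by
  have hfin : s.Finite := by
    by_contra hinf
    obtain ⟨t, hts, hcard⟩ := Set.Infinite.exists_subset_card_eq hinf (k + 1)
    exact h t hts hcard
  refine ⟨hfin, ?_⟩
  by_contra! hlt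
  rw [Set.ncard_eq_toFinset_card s hfin] at hlt
  obtain ⟨t, hts, hcard⟩ := Finset.exists_subset_card_eq (Nat.succ_le_of_lt hlt)
  exact h t (fun x hx => hfin.mem_toFinset.1 (hts hx)) hcard

theorem exists_last {p : ℕ → Prop} {n : ℕ} (hn : p n) (hlast : ∃ m, n ≤ m ∧ ¬ p m) :
    ∃ r, n ≤ r ∧ p r ∧ ¬ p (r + 1) := by
  by_contra! h
  obtain ⟨m, hnm, hm⟩ := hlast
  exact hm (Nat.le_induction hn (fun r hr hp => h r hr hp) m hnm)

/-- The logarithmic heights of two elements of a long chain of solutions are incompatible with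
the Padé estimates. -/
theorem heights_incompatible {B : ℝ} (hB : 5 / 6 < B) (hB1 : B < 1) {r₀ : ℤ} {k : ℕ}
    (hr : (6 + 3 * B) / (3 * B * (6 * B - 5)) < r₀)
    (hk : 3 * (r₀ : ℝ) + 4 < (3 * B - 1) ^ (k + 1)) {a h₀ h₁ : ℝ} (ha : 0 ≤ a)
    (hf : a * f₁ B r₀ + Real.log 24 * f₂ B r₀ < h₀)
    (hg : a * g₁ B k r₀ + Real.log 48 * g₂ B k r₀ - Real.log 2 * g₃ B k r₀ < h₀)
    (hchain : (3 * B - 1) ^ k * h₀ +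
      ((1 - B) * a - Real.log 48) * ∑ i ∈ Finset.range k, (3 * B - 1) ^ i ≤ h₁)
    (hpade : ∀ r : ℕ, 1 ≤ r → ∃ g : ℕ, g ≤ 1 ∧
      (0 ≤ Real.log 2 + r * Real.log 24 + (3 * r + 1 - g) * h₀ + h₁ +
          B * ((2 * r + 1 - g) * (a - 3 * h₀)) ∨
        0 ≤ Real.log 2 + r * Real.log 24 + (3 * r + 1 - g) * h₀ + h₁ + B * (a - 3 * h₁))) :
    False := by
  have hl2 : 0 < Real.log 2 := Real.log_pos (by norm_num)
  have hl24 : 0 < Real.log 24 := Real.log_pos (by norm_num)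
  have hl48 : Real.log 48 = Real.log 24 + Real.log 2 := by
    rw [← Real.log_mul (by norm_num) (by norm_num)]; norm_num
  have hl3 : 3 * Real.log 2 ≤ Real.log 24 := by
    rw [show (3 : ℝ) * Real.log 2 = Real.log (2 ^ 3) by rw [Real.log_pow]; norm_num]
    exact Real.log_le_log (by norm_num) (by norm_num)
  have hu : 0 < 3 * B * (6 * B - 5) := by
    have : 0 < 6 * B - 5 := by linarith
    positivity
  rw [div_lt_iff₀ hu] at hr
  have hr0 : (0 : ℝ) < r₀ := by
    by_contra h
    have := mul_nonpos_of_nonpos_of_nonneg (not_lt.1 h) hu.le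
    linarith
  -- the first lower bound for `h₀`, with denominators cleared
  have hD : 0 < 3 * r₀ * B * (6 * B - 5) - 6 - 3 * B := by linarith
  have hf' : (2 * r₀ * B * (3 * B - 1) + B) * a + (3 * r₀ * B + 3) * Real.log 24 <
      (3 * r₀ * B * (6 * B - 5) - 6 - 3 * B) * h₀ := by
    rw [f₁, f₂, mul_div_assoc', mul_div_assoc', ← add_div, div_lt_iff₀ hD] at hf
    linarith
  have hG : 0 < 3 * B - 1 := by linarith
  have hB0 : 0 < B := by linarith
  have hGa : 0 ≤ B * (3 * B - 1) * a := by positivity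
  have hh0 : 0 < h₀ := by
    by_contra h
    have h1 := mul_nonpos_of_nonneg_of_nonpos hD.le (not_lt.1 h)
    have h2 : 0 ≤ (2 * r₀ * B * (3 * B - 1) + B) * a := by positivity
    have h3 : 0 ≤ (3 * r₀ * B + 3) * Real.log 24 := by positivity
    linarith
  -- The part of the first bound proportional to `r₀`. Its positive slack will allow `r₀` to be
  -- replaced by a larger `r`.
  have hunit : 2 * B * (3 * B - 1) * a + 3 * B * Real.log 24 < 3 * B * (6 * B - 5) * h₀ := by
    have h1 : 0 ≤ (6 + 3 * B) * h₀ := by positivity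
    have h2 : 0 ≤ B * a := by positivity
    refine lt_of_mul_lt_mul_left ?_ hr0.le
    linarith
  have hah : a < h₀ := by
    have h1 : 3 * B * (6 * B - 5) * a ≤ 2 * B * (3 * B - 1) * a := by
      refine mul_le_mul_of_nonneg_right ?_ ha
      nlinarith
    have h2 : 0 ≤ 3 * B * Real.log 24 := by positivity
    exact lt_of_mul_lt_mul_left (by linarith) hu.le
  -- the second lower bound for `h₀`, combined with the chain inequality
  have hD' : 0 < (3 * B - 1) ^ (k + 1) - 3 * (r₀ : ℝ) - 4 := by linarith
  have hsum : ∑ i ∈ Finset.range k, (3 * B - 1) ^ i =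
      ((3 * B - 1) ^ k - 1) / (3 * B - 2) := by
    rw [geom_sum_eq (by linarith)]
    congr 1
    ring
  rw [hsum] at hchain
  set σ := ((3 * B - 1) ^ k - 1) / (3 * B - 2) with hσ
  have hbase : Real.log 2 + (r₀ + 1) * Real.log 24 + (3 * (r₀ + 1) + 1) * h₀ + B * a <
      (3 * B - 1) * h₁ := by
    have hg' : (B - (1 - B) * (3 * B - 1) * σ) * a + (r₀ + 1 + (3 * B - 1) * σ) * Real.log 48 -
        r₀ * Real.log 2 < ((3 * B - 1) ^ (k + 1) - 3 * r₀ - 4) * h₀ := by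
      have hz1 : ((3 * B - 1) ^ (k : ℤ) : ℝ) = (3 * B - 1) ^ k := zpow_natCast _ _
      have hz2 : ((3 * B - 1) ^ ((k : ℤ) + 1) : ℝ) = (3 * B - 1) ^ (k + 1) := by
        exact_mod_cast zpow_natCast (3 * B - 1) (k + 1)
      have e : a * g₁ B k r₀ + Real.log 48 * g₂ B k r₀ - Real.log 2 * g₃ B k r₀ =
          ((B - (1 - B) * (3 * B - 1) * σ) * a + (r₀ + 1 + (3 * B - 1) * σ) * Real.log 48 -
            r₀ * Real.log 2) / ((3 * B - 1) ^ (k + 1) - 3 * r₀ - 4) := by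
        rw [g₁, g₂, g₃, hz1, hz2, ← hσ]
        ring
      rw [e, div_lt_iff₀ hD'] at hg
      linarith
    -- With `log 48 = log 24 + log 2`, one has `(r₀ + 1) log 48 - r₀ log 2 = log 2 + (r₀ + 1) log
    -- 24`; this explains `g₂` and `g₃`.
    have h1 := mul_le_mul_of_nonneg_left hchain hG.le
    rw [pow_succ] at hg'
    rw [hl48] at hg' h1
    linarith
  obtain ⟨n, hn⟩ : ∃ n : ℕ, (n : ℤ) = r₀ :=
    ⟨r₀.toNat, Int.toNat_of_nonneg (by exact_mod_cast hr0.le)⟩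
  have hnr : (n : ℝ) = r₀ := by exact_mod_cast hn
  -- The property says that `h₁` is too large for the second Padé alternative. It holds at `r₀ + 1`
  -- and fails eventually because `h₀ > 0`; at the last `r` its failure at `r + 1` bounds `h₁`
  -- above.
  obtain ⟨r, hr1, hp, hnp⟩ := exists_last
    (p := fun r : ℕ => Real.log 2 + r * Real.log 24 + (3 * r + 1) * h₀ + B * a <
      (3 * B - 1) * h₁) (n := n + 1) (by push_cast; rw [hnr]; exact hbase) (by
        obtain ⟨M, hM⟩ := exists_nat_gt ((3 * B - 1) * h₁ / h₀)
        rw [div_lt_iff₀ hh0] at hM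
        refine ⟨n + 1 + M, by omega, ?_⟩
        push_cast
        have h1 : (0 : ℝ) ≤ (n + 1 + M) * Real.log 24 := by positivity
        have h2 : (0 : ℝ) ≤ n * h₀ := by positivity
        have h3 : (0 : ℝ) ≤ M * h₀ := by positivity
        have h4 : 0 ≤ B * a := by positivity
        linarith)
  push_cast at hnp
  rw [not_lt] at hnp
  have hr1' : (r₀ : ℝ) + 1 ≤ r := by rw [← hnr]; exact_mod_cast hr1
  obtain ⟨g, hg1, hcase⟩ := hpade r (by omega)
  have hg1' : (g : ℝ) ≤ 1 := by exact_mod_cast hg1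
  have hg0 : (0 : ℝ) ≤ g := g.cast_nonneg
  rcases hcase with hcase | hcase
  -- First alternative: `a < h₀` removes the dependence on `g`. After multiplying by `3B - 1` and
  -- inserting the upper bound for `h₁`, the coefficient of `r h₀` is `(3B - 1)(6B - 3) - 3 = 3B(6B
  -- - 5)`, and the first lower bound for `h₀` is violated.
  · have h1 : (1 - (g : ℝ)) * (B * a) ≤ (1 - (g : ℝ)) * ((3 * B - 1) * h₀) := by
      refine mul_le_mul_of_nonneg_left ?_ (by linarith)
      exact mul_le_mul (by linarith) hah.le ha hG.le
    have h2 : (6 * B - 3) * r * h₀ ≤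
        Real.log 2 + r * Real.log 24 + 2 * B * r * a + h₁ := by linarith
    have h3 := mul_le_mul_of_nonneg_left h2 hG.le
    have h4 : (r - (r₀ : ℝ)) * (2 * B * (3 * B - 1) * a + 3 * B * Real.log 24) ≤
        (r - r₀) * (3 * B * (6 * B - 5) * h₀) :=
      mul_le_mul_of_nonneg_left hunit.le (by linarith)
    have h5 : B * (3 * Real.log 2) ≤ 1 * Real.log 24 :=
      mul_le_mul hB1.le hl3 (by positivity) zero_le_one
    have h6 : 0 ≤ B * h₀ := by positivity
    linarith
  · have h1 : 0 ≤ g * h₀ := by positivity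
    linarith

end RealEstimates

/-! ### Logarithmic form of the inequalities, and the main theorem. -/

section LogarithmicForms

theorem log_gap {c H H' B : ℝ} (hc : 0 < c) (hH : 0 < H) (hH' : 0 < H')
    (h : c ≤ 48 * H * H' * (c / H ^ 3) ^ B) :
    (3 * B - 1) * Real.log H + ((1 - B) * Real.log c - Real.log 48) ≤ Real.log H' := by
  have hX : 0 < c / H ^ 3 := by positivity
  have h1 := Real.log_le_log hc h
  rw [Real.log_mul (by positivity) (Real.rpow_pos_of_pos hX B).ne', Real.log_mul (by positivity)
    hH'.ne', Real.log_mul (by norm_num) hH.ne', Real.log_rpow hX, Real.log_div hc.ne'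
    (by positivity), Real.log_pow] at h1
  push_cast at h1
  linarith

theorem log_pade {c H H' B : ℝ} {r g : ℕ} (hc : 0 < c) (hH : 0 < H) (hH' : 0 < H') (hg : g ≤ 1)
    (h : 1 ≤ 2 * 24 ^ r * H ^ (3 * r + 1 - g) * H' *
      (max ((c / H ^ 3) ^ (2 * r + 1 - g)) (c / H' ^ 3)) ^ B) :
    0 ≤ Real.log 2 + r * Real.log 24 + (3 * r + 1 - g) * Real.log H + Real.log H' +
          B * ((2 * r + 1 - g) * (Real.log c - 3 * Real.log H)) ∨
      0 ≤ Real.log 2 + r * Real.log 24 + (3 * r + 1 - g) * Real.log H + Real.log H' +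
          B * (Real.log c - 3 * Real.log H') := by
  have hX : 0 < c / H ^ 3 := by positivity
  have hX' : 0 < c / H' ^ 3 := by positivity
  have hXp : 0 < (c / H ^ 3) ^ (2 * r + 1 - g) := by positivity
  have e1 : ((3 * r + 1 - g : ℕ) : ℝ) = 3 * r + 1 - g := by
    rw [Nat.cast_sub (by omega)]; push_cast; ring
  have e2 : ((2 * r + 1 - g : ℕ) : ℝ) = 2 * r + 1 - g := by
    rw [Nat.cast_sub (by omega)]; push_cast; ring
  have key : ∀ Z : ℝ, 0 < Z → 1 ≤ 2 * 24 ^ r * H ^ (3 * r + 1 - g) * H' * Z ^ B →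
      0 ≤ Real.log 2 + r * Real.log 24 + (3 * r + 1 - g) * Real.log H + Real.log H' +
        B * Real.log Z := by
    intro Z hZ h
    have h1 := Real.log_le_log one_pos h
    rw [Real.log_one, Real.log_mul (by positivity) (Real.rpow_pos_of_pos hZ B).ne',
      Real.log_mul (by positivity) hH'.ne', Real.log_mul (by positivity) (by positivity),
      Real.log_mul (by norm_num) (by positivity), Real.log_pow, Real.log_pow, Real.log_rpow hZ,
      e1] at h1
    exact h1
  rcases max_choice ((c / H ^ 3) ^ (2 * r + 1 - g)) (c / H' ^ 3) with hm | hm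
  · rw [hm] at h
    left
    have := key _ hXp h
    rw [Real.log_pow, Real.log_div hc.ne' (by positivity), Real.log_pow, e2] at this
    exact_mod_cast this
  · rw [hm] at h
    right
    have := key _ hX' h
    rw [Real.log_div hc.ne' (by positivity), Real.log_pow] at this
    exact_mod_cast this

theorem nonneg_of_lt_zpow {x y : ℝ} {k : ℤ} (hx : 1 < x) (hy : 1 ≤ y) (h : y < x ^ (k + 1)) :
    0 ≤ k := by
  by_contra! hk
  have h1 : x ^ (k + 1) ≤ x ^ (0 : ℤ) := zpow_le_zpow_right₀ hx.le (by omega)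
  rw [zpow_zero] at h1
  linarith

end LogarithmicForms

end SUnitPade

theorem lemma8 {K L : Type*} [Field K] [NumberField K] [Field L] [NumberField L] [Algebra K L]
    (ρ : L) (hρ : IsPrimitiveRoot ρ 3) (hL : IntermediateField.adjoin K {ρ} = ⊤)
    (l m : K) (hl : l ≠ 0) (hm : m ≠ 0)
    (S : Finset (SUnitPade.Place K)) (hS : ∀ w : InfinitePlace K, Sum.inl w ∈ S)
    (B : ℝ) (hB : 5 / 6 < B) (hB1 : B < 1)
    (rhoV : SUnitPade.Place L → L) (Gam : SUnitPade.Place L → ℝ)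
    (hrhoV : ∀ V ∈ SUnitPade.placesAbove L S, rhoV V ^ 3 = 1)
    (hGam : ∀ V ∈ SUnitPade.placesAbove L S, 0 ≤ Gam V)
    (hsum : ∑ V ∈ SUnitPade.placesAbove L S, Gam V = B)
    (r₀ k : ℤ) (hr : (6 + 3 * B) / (3 * B * (6 * B - 5)) < r₀)
    (hk : 3 * (r₀ : ℝ) + 4 < (3 * B - 1) ^ (k + 1)) :
    {z : L | z ∈ SUnitPade.V0 S ρ l m ∧
      SUnitPade.SatisfiesSystem S l m rhoV Gam z ∧
      max ((8 * SUnitPade.constA L S l m) ^ SUnitPade.f₁ B r₀ *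
            (24 : ℝ) ^ SUnitPade.f₂ B r₀)
          ((8 * SUnitPade.constA L S l m) ^ SUnitPade.g₁ B k r₀ *
            (48 : ℝ) ^ SUnitPade.g₂ B k r₀ * (2 : ℝ) ^ (-SUnitPade.g₃ B k r₀))
        < SUnitPade.height z}.Finite ∧
    (({z : L | z ∈ SUnitPade.V0 S ρ l m ∧
      SUnitPade.SatisfiesSystem S l m rhoV Gam z ∧
      max ((8 * SUnitPade.constA L S l m) ^ SUnitPade.f₁ B r₀ *
            (24 : ℝ) ^ SUnitPade.f₂ B r₀)
          ((8 * SUnitPade.constA L S l m) ^ SUnitPade.g₁ B k r₀ *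
            (48 : ℝ) ^ SUnitPade.g₂ B k r₀ * (2 : ℝ) ^ (-SUnitPade.g₃ B k r₀))
        < SUnitPade.height z}.ncard : ℤ) ≤ k) := by
  have hden : 0 < 3 * B * (6 * B - 5) := by
    have h1 : 0 < 6 * B - 5 := by linarith
    have h2 : 0 < B := by linarith
    positivity
  have hr0 : (0 : ℝ) < r₀ := lt_trans (div_pos (by linarith) hden) hr
  -- `k` is an arbitrary integer, but a power of `3B - 1 > 1` exceeding `1` has a positive exponent.
  have hk0 : 0 ≤ k := SUnitPade.nonneg_of_lt_zpow (by linarith : 1 < 3 * B - 1)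
    (by linarith : 1 ≤ 3 * (r₀ : ℝ) + 4) hk
  lift k to ℕ using hk0
  have hk' : 3 * (r₀ : ℝ) + 4 < (3 * B - 1) ^ (k + 1) := by exact_mod_cast hk
  set s : Set L := {z : L | z ∈ SUnitPade.V0 S ρ l m ∧
      SUnitPade.SatisfiesSystem S l m rhoV Gam z ∧
      max ((8 * SUnitPade.constA L S l m) ^ SUnitPade.f₁ B r₀ *
            (24 : ℝ) ^ SUnitPade.f₂ B r₀)
          ((8 * SUnitPade.constA L S l m) ^ SUnitPade.g₁ B k r₀ *
            (48 : ℝ) ^ SUnitPade.g₂ B k r₀ * (2 : ℝ) ^ (-SUnitPade.g₃ B k r₀))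
        < SUnitPade.height z} with hs
  suffices h : ∀ t : Finset L, (t : Set L) ⊆ s → t.card ≠ k + 1 by
    obtain ⟨h1, h2⟩ := SUnitPade.finite_and_ncard_le h
    exact ⟨h1, by exact_mod_cast h2⟩
  intro t hts hcard
  have hH : ∀ z : L, 0 < SUnitPade.height z := fun z => one_pos.trans_le (SUnitPade.one_le_height z)
  have hApos : ∀ z ∈ s, 1 ≤ SUnitPade.constA L S l m := fun z hz =>
    SUnitPade.one_le_constA hρ hl hm hS hz.1
  have hgap : ∀ z ∈ s, ∀ z' ∈ s, z ≠ z' →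
      Real.log (SUnitPade.height z) ≤ Real.log (SUnitPade.height z') →
      (3 * B - 1) * Real.log (SUnitPade.height z) +
        ((1 - B) * Real.log (8 * SUnitPade.constA L S l m) - Real.log 48) ≤
        Real.log (SUnitPade.height z') := by
    intro z hz z' hz' hne hle
    have hA := hApos z hz
    refine SUnitPade.log_gap (by positivity) (hH z) (hH z') ?_
    exact SUnitPade.gap_of_mem_V0 hρ hl hm hS hrhoV hGam hsum hz.1 hz'.1 hne hz.2.1 hz'.2.1
      ((Real.log_le_log_iff (hH z) (hH z')).1 hle)
  -- Given `k + 1` solutions, the two ends of the chain supply the pair of heights to be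
  -- contradicted by the Padé estimates.
  obtain ⟨z, hz, z', hz', hchain⟩ := SUnitPade.exists_pow_mul_add_le (by linarith) hgap k t hts hcard
  have hz := hts hz
  have hz' := hts hz'
  have hA := hApos z hz
  have hc : 0 < 8 * SUnitPade.constA L S l m := by positivity
  obtain ⟨hzf, hzg⟩ := max_lt_iff.1 hz.2.2
  refine SUnitPade.heights_incompatible hB hB1 hr hk' (a := Real.log (8 * SUnitPade.constA L S l m))
    (h₀ := Real.log (SUnitPade.height z)) (h₁ := Real.log (SUnitPade.height z'))
    (Real.log_nonneg (by linarith)) ?_ ?_ hchain ?_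
  · have h := Real.log_lt_log (by positivity) hzf
    rw [Real.log_mul (by positivity) (by positivity), Real.log_rpow hc,
      Real.log_rpow (by norm_num)] at h
    linarith
  · have h := Real.log_lt_log (by positivity) hzg
    rw [Real.log_mul (by positivity) (by positivity), Real.log_mul (by positivity) (by positivity),
      Real.log_rpow hc, Real.log_rpow (by norm_num), Real.log_rpow (by norm_num)] at h
    linarith
  · intro r hr1
    obtain ⟨g, hg, h⟩ := SUnitPade.pade_of_mem_V0 hρ hl hm hS hrhoV hGam hsum hz.1 hz'.1 hz.2.1
      hz'.2.1 hr1
    exact ⟨g, hg, SUnitPade.log_pade hc (hH z) (hH z') hg h⟩
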